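/- Let $M$ be a smooth manifold of dimension $m$ (Hausdorff, second countable, without boundary; not necessarily compact or connected), equipped with a smooth Riemannian metric $g$ and an orientation. Let $E^p(M)$ be the space of smooth real $p$-forms on $M$, and let $d : E^p(M)\to E^{p+1}(M)$ be the exterior derivative. The dual metric on $T_x^*M$ induces an inner product $\langle\cdot,\cdot\rangle$ on each $\Lambda^p(T_x^*M)$, for which the forms $e^{i_1}\wedge\dots\wedge e^{i_p}$, $i_1<\dots<i_p$, are orthonormal whenever $e^1,\dots,e^m$ is an orthonormal basis of $T^*_xM$. Let $dV\in E^m(M)$ be the Riemannian volume element determined by the metric and the orientation, and let $\star : E^p(M)\to E^{m-p}(M)$, $0\le p\le m$, be the operator defined pointwise by $u\wedge\star v=\langle u,v\rangle\,dV$ for all $u,v\in\Lambda^p(T_x^*M)$. For compactly supported $u,v\in E^p(M)$ put $$\langle\langle u,v\rangle\rangle=\int_M\langle u,v\rangle\,dV .$$ For $1\le p\le m$ define $$d^\star=(-1)^{m(p+1)+1}\star d\,\star \quad\text{on } p\text{-forms},$$ and let $d^\star=0$ on $p$-forms with $p>m$, which are all zero. Then, for every $p\ge 1$, the operator $d^\star$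 is the formal adjoint of $d : E^{p-1}(M)\to E^p(M)$: $d$ and $d^\star$ are linear maps $d : E^{p-1}(M)\to E^p(M)$ and $d^\star : E^p(M)\to E^{p-1}(M)$, and for all compactly supported $u\in E^{p-1}(M)$ and $v\in E^p(M)$ $$\langle\langle du,v\rangle\rangle=\langle\langle u,d^\star v\rangle\rangle .$$ -/

import Mathlib

open Set Bundle Manifold MeasureTheory
open scoped ContDiff Topology

noncomputable section

namespace RiemannianForms

/-! ### Exterior algebra of an oriented Euclidean space -/

section LinearAlgebra

variable {V : Type*} [NormedAddCommGroup V] [InnerProductSpace ℝ V] [FiniteDimensional ℝ V]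
variable {m p q : ℕ}

/-- The inner product on `Λ^p(V*)` induced by the (dual) metric: if `e` is an orthonormal basis of
`V`, then the `e^I = e^{i₁} ∧ ⋯ ∧ e^{i_p}`, `i₁ < ⋯ < i_p`, form an orthonormal basis of `Λ^p(V*)`,
and the coefficient of `α` at `e^I` is `α (e_{i₁}, …, e_{i_p})`. -/
def formInner (α β : V [⋀^Fin p]→L[ℝ] ℝ) : ℝ :=
  ∑ I : Fin p ↪o Fin (Module.finrank ℝ V),
    α (stdOrthonormalBasis ℝ V ∘ I) * β (stdOrthonormalBasis ℝ V ∘ I)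

/-- The identification of `{1, …, p} ⊔ {1, …, q}` with `{1, …, m}`, `p + q = m`, which lists the
first set before the second one. -/
def sumEquiv (h : p + q = m) : Fin p ⊕ Fin q ≃ Fin m :=
  finSumFinEquiv.trans (finCongr h)

/-- The exterior product `Λ^p(V*) × Λ^q(V*) → Λ^m(V*)`, `p + q = m`, a sum over shuffles. -/
def wedge (h : p + q = m) (α : V [⋀^Fin p]→L[ℝ] ℝ) (β : V [⋀^Fin q]→L[ℝ] ℝ) :
    V [⋀^Fin m]→ₗ[ℝ] ℝ :=
  ((LinearMap.mul' ℝ ℝ).compAlternatingMap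
    (α.toAlternatingMap.domCoprod β.toAlternatingMap)).domDomCongr (sumEquiv h)

variable [Fact (Module.finrank ℝ V = m)]

/-- The volume element `dV ∈ Λ^m(V*)` of an oriented Euclidean space: it is `1` on positively
oriented orthonormal bases. -/
def volForm (o : Orientation ℝ V (Fin m)) : V [⋀^Fin m]→L[ℝ] ℝ :=
  o.volumeForm.mkContinuous 1 fun v => by
    simpa [Real.norm_eq_abs] using o.abs_volumeForm_apply_le v

/-- The alternating `q`-form `w ↦ dV (a₁, …, a_p, w₁, …, w_q)`, where `p + q = m`. -/
def volContract (o : Orientation ℝ V (Fin m)) (h : p + q = m) (a : Fin p → V) :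
    V [⋀^Fin q]→L[ℝ] ℝ :=
  AlternatingMap.mkContinuous
    { toFun := fun w => o.volumeForm (Sum.elim a w ∘ (sumEquiv h).symm)
      map_update_add' := by
        intro inst w i x y
        obtain rfl : inst = instDecidableEqFin q := Subsingleton.elim _ _
        have key : ∀ z : V, (Sum.elim a (Function.update w i z) ∘ (sumEquiv h).symm) =
            Function.update (Sum.elim a w ∘ (sumEquiv h).symm) (sumEquiv h (Sum.inr i)) z := by
          intro z
          rw [← Sum.update_elim_inr, Function.update_comp_equiv, Equiv.symm_symm]
        simp only [key, AlternatingMap.map_update_add]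
      map_update_smul' := by
        intro inst w i c x
        obtain rfl : inst = instDecidableEqFin q := Subsingleton.elim _ _
        have key : ∀ z : V, (Sum.elim a (Function.update w i z) ∘ (sumEquiv h).symm) =
            Function.update (Sum.elim a w ∘ (sumEquiv h).symm) (sumEquiv h (Sum.inr i)) z := by
          intro z
          rw [← Sum.update_elim_inr, Function.update_comp_equiv, Equiv.symm_symm]
        simp only [key, AlternatingMap.map_update_smul]
      map_eq_zero_of_eq' := by
        intro w i j hw hij
        refine o.volumeForm.map_eq_zero_of_eq _ (i := sumEquiv h (Sum.inr i))
          (j := sumEquiv h (Sum.inr j)) ?_ ?_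
        · simpa using hw
        · simpa using hij }
    (∏ i, ‖a i‖) fun w => by
      refine (o.abs_volumeForm_apply_le _).trans_eq ?_
      rw [← Equiv.prod_comp (sumEquiv h)]
      simp [Fintype.prod_sum_type]

theorem volContract_apply (o : Orientation ℝ V (Fin m)) (h : p + q = m) (a : Fin p → V)
    (w : Fin q → V) :
    volContract o h a w = o.volumeForm (Sum.elim a w ∘ (sumEquiv h).symm) := rfl

/-- The star operator `Λ^p(V*) → Λ^q(V*)`, `p + q = m`, of an oriented Euclidean space,
`⋆ v = ∑_I v_I (⋆ e^I)`, where `v_I = v (e_I)` are the coefficients of `v` in an orthonormal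
basis and `⋆ e^I = dV (e_I, ·)`, that is, `⋆ e^I = ε(I, CI) e^{CI}` if the basis is positively
oriented. See `wedge_hodgeStar` for the property `u ∧ ⋆ v = ⟨u, v⟩ dV`. -/
def hodgeStar (o : Orientation ℝ V (Fin m)) (h : p + q = m) (v : V [⋀^Fin p]→L[ℝ] ℝ) :
    V [⋀^Fin q]→L[ℝ] ℝ :=
  ∑ I : Fin p ↪o Fin (Module.finrank ℝ V),
    v (stdOrthonormalBasis ℝ V ∘ I) • volContract o h (stdOrthonormalBasis ℝ V ∘ I)

/-- The permutation `(I, CI)` of `{1, …, m}`. -/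
theorem exists_complement {n : ℕ} (h : p + q = n) (I : Fin p ↪o Fin n) :
    ∃ σ : Equiv.Perm (Fin p ⊕ Fin q), ∀ i, sumEquiv h (σ (Sum.inl i)) = I i := by
  have h1 : (Finset.univ.map I.toEmbedding).card = p := by simp
  have h2 : (Finset.univ.map I.toEmbedding)ᶜ.card = q := by
    rw [Finset.card_compl, h1]; simp; omega
  refine ⟨(finSumEquivOfFinset h1 h2).trans (sumEquiv h).symm, fun i => ?_⟩
  have : I = (Finset.univ.map I.toEmbedding).orderEmbOfFin h1 := by
    apply Finset.orderEmbOfFin_unique'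
    simp
  conv_rhs => rw [this]
  simp

/-- The defining property `u ∧ ⋆ v = ⟨u, v⟩ dV` of the star operator. -/
theorem wedge_hodgeStar (o : Orientation ℝ V (Fin m)) (h : p + q = m) (u v : V [⋀^Fin p]→L[ℝ] ℝ) :
    wedge h u (hodgeStar o h v) = formInner u v • o.volumeForm := by
  obtain rfl : Module.finrank ℝ V = m := Fact.out
  set e := stdOrthonormalBasis ℝ V with he
  rw [AlternatingMap.eq_smul_basis_det e.toBasis (wedge h u (hodgeStar o h v)),
    AlternatingMap.eq_smul_basis_det e.toBasis (formInner u v • o.volumeForm)]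
  congr 1
  simp only [OrthonormalBasis.coe_toBasis]
  have hR : (formInner u v • o.volumeForm) e = ∑ I : Fin p ↪o Fin (Module.finrank ℝ V),
      u (e ∘ I) * v (e ∘ I) * o.volumeForm e := by
    rw [← Finset.sum_mul]; rfl
  have hL : wedge h u (hodgeStar o h v) e =
      ∑ c : Equiv.Perm.ModSumCongr (Fin p) (Fin q), LinearMap.mul' ℝ ℝ
        (AlternatingMap.domCoprod.summand u.toAlternatingMap (hodgeStar o h v).toAlternatingMap c
          fun i => e (sumEquiv h i)) := by
    simp only [wedge, AlternatingMap.domDomCongr_apply, LinearMap.compAlternatingMap_apply,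
      AlternatingMap.domCoprod_apply, sum_apply, map_sum]
    rfl
  rw [hR, hL]
  choose σ hσ using fun I : Fin p ↪o Fin (Module.finrank ℝ V) => exists_complement h I
  symm
  have hbij : Function.Bijective fun I : Fin p ↪o Fin (Module.finrank ℝ V) =>
      (Quotient.mk'' (σ I) : Equiv.Perm.ModSumCongr (Fin p) (Fin q)) := by
    constructor
    · intro I J hIJ
      obtain ⟨⟨a, b⟩, hab⟩ := QuotientGroup.leftRel_apply.mp (Quotient.exact' hIJ)
      have hJ : ∀ i, J i = I (a i) := by
        intro i
        rw [← hσ, ← hσ]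
        have : σ J = σ I * Equiv.Perm.sumCongrHom _ _ (a, b) := by rw [hab]; group
        rw [this]; simp
      apply DFunLike.ext'
      refine (StrictMono.range_inj I.strictMono J.strictMono).1 ?_
      ext x
      constructor
      · rintro ⟨i, rfl⟩; exact ⟨a⁻¹ i, by simp [hJ]⟩
      · rintro ⟨i, rfl⟩; exact ⟨a i, by simp [hJ]⟩
    · intro c
      induction c using Quotient.inductionOn' with | _ τ
      let f : Fin p ↪ Fin (Module.finrank ℝ V) :=
        ⟨fun i => sumEquiv h (τ (Sum.inl i)), fun i j hij => by simpa using hij⟩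
      have h1 : (Finset.univ.map f).card = p := by simp
      refine ⟨(Finset.univ.map f).orderEmbOfFin h1, ?_⟩
      refine Quotient.sound' (QuotientGroup.leftRel_apply.mpr ?_)
      apply Equiv.Perm.mem_sumCongrHom_range_of_perm_mapsTo_inl
      rintro _ ⟨i, rfl⟩
      have := Finset.orderEmbOfFin_mem (Finset.univ.map f) h1
      have h3 : f i ∈ Set.range ((Finset.univ.map f).orderEmbOfFin h1) := by
        rw [Finset.range_orderEmbOfFin]; simp
      obtain ⟨j, hj⟩ := h3
      refine ⟨j, ?_⟩
      rw [← hσ] at hj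
      have hj' : σ _ (Sum.inl j) = τ (Sum.inl i) := (sumEquiv h).injective hj
      rw [Equiv.Perm.mul_apply, ← hj']; simp
  refine Fintype.sum_bijective _ hbij _ _ fun I => ?_
  rw [AlternatingMap.domCoprod.summand_mk'']
  have hI : (fun i => e (sumEquiv h (σ I (Sum.inl i)))) = e ∘ I := by
    funext i; simp [hσ]
  have hstar : hodgeStar o h v (fun i => e (sumEquiv h (σ I (Sum.inr i)))) =
      v (e ∘ I) * ((Equiv.Perm.sign (σ I) : ℤ) * o.volumeForm e) := by
    have hsum : hodgeStar o h v (fun i => e (sumEquiv h (σ I (Sum.inr i)))) =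
        ∑ J : Fin p ↪o Fin (Module.finrank ℝ V), v (e ∘ J) *
          o.volumeForm (Sum.elim (e ∘ J) (fun i => e (sumEquiv h (σ I (Sum.inr i)))) ∘
            (sumEquiv h).symm) := by
      rw [hodgeStar, ContinuousAlternatingMap.sum_apply]
      rfl
    rw [hsum, Finset.sum_eq_single I]
    · congr 1
      have : Sum.elim (e ∘ I) (fun i => e (sumEquiv h (σ I (Sum.inr i)))) ∘ (sumEquiv h).symm =
          e ∘ ((sumEquiv h).permCongr (σ I)) := by
        funext x
        obtain ⟨y, rfl⟩ := (sumEquiv h).surjective x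
        rcases y with i | i
        · simp [hσ]
        · simp
      rw [this, AlternatingMap.map_perm, Equiv.Perm.sign_permCongr]
      simp [Units.smul_def]
    · intro J _ hJ
      obtain ⟨i, hi⟩ : ∃ i, J i ∉ Set.range I := by
        by_contra! hcon
        apply hJ
        have h1 : (Finset.univ.map I.toEmbedding).card = p := by simp
        have hJ1 : (J : Fin p → _) = (Finset.univ.map I.toEmbedding).orderEmbOfFin h1 :=
          Finset.orderEmbOfFin_unique h1 (fun x => by
            obtain ⟨y, hy⟩ := hcon x
            simp [← hy]) J.strictMono
        have hI1 : (I : Fin p → _) = (Finset.univ.map I.toEmbedding).orderEmbOfFin h1 :=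
          Finset.orderEmbOfFin_unique h1 (fun x => by simp) I.strictMono
        exact DFunLike.ext' (hJ1.trans hI1.symm)
      obtain ⟨y, hy⟩ := (sumEquiv h).surjective (J i)
      obtain ⟨y, rfl⟩ := (σ I).surjective y
      rcases y with a | a
      · exact absurd ⟨a, by rw [← hσ, hy]⟩ hi
      · rw [o.volumeForm.map_eq_zero_of_eq _ (i := sumEquiv h (Sum.inl i))
          (j := sumEquiv h (Sum.inr a)), mul_zero]
        · simp [hy]
        · simp
    · simp
  have hsq : ((Equiv.Perm.sign (σ I) : ℤ) : ℝ) * ((Equiv.Perm.sign (σ I) : ℤ) : ℝ) = 1 := by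
    rcases Int.units_eq_one_or (Equiv.Perm.sign (σ I)) with h | h <;> simp [h]
  have hterm : LinearMap.mul' ℝ ℝ ((Equiv.Perm.sign (σ I) •
      (MultilinearMap.domCoprod (u.toAlternatingMap : MultilinearMap ℝ (fun _ => V) ℝ)
        (hodgeStar o h v).toAlternatingMap).domDomCongr (σ I)) fun i => e (sumEquiv h i)) =
      ((Equiv.Perm.sign (σ I) : ℤ) : ℝ) * (u (fun i => e (sumEquiv h (σ I (Sum.inl i)))) *
        hodgeStar o h v (fun i => e (sumEquiv h (σ I (Sum.inr i))))) := by
    rw [smul_apply, Units.smul_def, map_zsmul, zsmul_eq_mul]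
    rfl
  rw [hterm, hI, hstar]
  linear_combination (-(u (e ∘ I) * v (e ∘ I) * o.volumeForm e)) * hsq

/-- The sign of an `m`-tuple of vectors with respect to an orientation: `1` for a positively
oriented basis, `-1` for a negatively oriented basis, `0` for linearly dependent vectors. -/
def frameSign {W : Type*} [AddCommGroup W] [Module ℝ W] (o : Orientation ℝ W (Fin m))
    (w : Fin m → W) : ℝ :=
  SignType.sign (o.someVector w)

end LinearAlgebra

/-! ### Differential forms on manifolds -/

section Manifold

variable {m : ℕ} {M : Type*} [TopologicalSpace M] [ChartedSpace (EuclideanSpace ℝ (Fin m)) M]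

variable (m M) in
/-- Arbitrary (not necessarily smooth) sections of `Λ^p(T*M)`. -/
abbrev Form (p : ℕ) : Type _ := ∀ x : M, (TangentSpace (𝓡 m) x) [⋀^Fin p]→L[ℝ] ℝ

/-- The expression of a `p`-form in the chart `φ` at `x₀`, i.e. `(φ⁻¹)^* u`, a `p`-form on
`φ.target ⊆ ℝ^m`. -/
def inChart {p : ℕ} (x₀ : M) (u : Form m M p) (z : EuclideanSpace ℝ (Fin m)) :
    (EuclideanSpace ℝ (Fin m)) [⋀^Fin p]→L[ℝ] ℝ :=
  (u ((extChartAt (𝓡 m) x₀).symm z)).compContinuousLinearMap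
    (mfderiv 𝓘(ℝ, EuclideanSpace ℝ (Fin m)) (𝓡 m) (extChartAt (𝓡 m) x₀).symm z)

/-- Smooth forms: the elements of `E^p(M)`. -/
def IsSmoothForm {p : ℕ} (u : Form m M p) : Prop :=
  ∀ x₀ : M, ContDiffOn ℝ ∞ (inChart x₀ u) (extChartAt (𝓡 m) x₀).target

/-- Forms with compact support. -/
def IsCompactlySupported {p : ℕ} (u : Form m M p) : Prop :=
  IsCompact (closure {x : M | u x ≠ 0})

/-- The exterior derivative, computed at `x` in the chart at `x`. -/
def extDer {p : ℕ} (u : Form m M p) : Form m M (p + 1) := fun x =>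
  (extDeriv (inChart x u) (extChartAt (𝓡 m) x x)).compContinuousLinearMap
    (mfderiv (𝓡 m) 𝓘(ℝ, EuclideanSpace ℝ (Fin m)) (extChartAt (𝓡 m) x) x)

/-! ### Orientations and integration -/

/-- The coordinate frame `∂_{x₁}, …, ∂_{x_m}` of the chart at `x₀`, at the point of `M` with
coordinates `z`. -/
def coordFrame (x₀ : M) (z : EuclideanSpace ℝ (Fin m)) (i : Fin m) :
    TangentSpace (𝓡 m) ((extChartAt (𝓡 m) x₀).symm z) :=
  mfderiv 𝓘(ℝ, EuclideanSpace ℝ (Fin m)) (𝓡 m) (extChartAt (𝓡 m) x₀).symm z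
    (EuclideanSpace.single i (1 : ℝ))

/-- The sign of the chart at `x₀` at the point with coordinates `z`: `1` if the chart preserves the
orientation there, `-1` if it reverses it. -/
def chartSign (o : ∀ x : M, Orientation ℝ (TangentSpace (𝓡 m) x) (Fin m)) (x₀ : M)
    (z : EuclideanSpace ℝ (Fin m)) : ℝ :=
  frameSign (o ((extChartAt (𝓡 m) x₀).symm z)) (coordFrame x₀ z)

variable (m M) in
/-- An orientation of a manifold: a choice of a half-line of `Λ^m(T_x^*M) ∖ {0}` for each `x`, which
depends continuously on `x`, i.e. whose sign with respect to each chart is locally constant. -/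
structure ManifoldOrientation where
  /-- The orientation of the tangent space at `x`, a half-line in the space of `m`-forms. -/
  orient : ∀ x : M, Orientation ℝ (TangentSpace (𝓡 m) x) (Fin m)
  continuousOn : ∀ x₀ : M, ContinuousOn (chartSign orient x₀) (extChartAt (𝓡 m) x₀).target

/-- The integral over a chart domain of an `m`-form `σ` whose support is contained in it:
if `(φ⁻¹)^* σ = f dx₁ ∧ ⋯ ∧ dx_m`, then it is `∫ f dx` if the chart preserves the orientation, and
`-∫ f dx` if it reverses the orientation. -/
def chartIntegral (o : ManifoldOrientation m M) (x₀ : M) (σ : Form m M m) : ℝ :=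
  ∫ z in (extChartAt (𝓡 m) x₀).target,
    chartSign o.orient x₀ z * inChart x₀ σ z (fun i => EuclideanSpace.single i (1 : ℝ))

section Integral

variable [IsManifold (𝓡 m) ∞ M] [T2Space M] [SecondCountableTopology M]

variable (m M) in
theorem exists_chartPartition :
    ∃ ρ : SmoothPartitionOfUnity M (𝓡 m) M univ,
      ρ.IsSubordinate fun x => (chartAt (EuclideanSpace ℝ (Fin m)) x).source := by
  have : LocallyCompactSpace M := Manifold.locallyCompact_of_finiteDimensional (𝓡 m)
  exact SmoothPartitionOfUnity.exists_isSubordinate_chartAt_source (𝓡 m) M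

variable (m M) in
/-- A smooth partition of unity subordinate to the covering of `M` by chart domains. -/
def chartPartition : SmoothPartitionOfUnity M (𝓡 m) M univ :=
  (exists_chartPartition m M).choose

/-- The integral `∫_M σ = ∑_α ∫_{U_α} ρ_α σ` of a (smooth, compactly supported) `m`-form over an
oriented manifold. -/
def formIntegral (o : ManifoldOrientation m M) (σ : Form m M m) : ℝ :=
  ∑ᶠ x₀ : M, chartIntegral o x₀ (fun x => chartPartition m M x₀ x • σ x)

end Integral

/-! ### Oriented Riemannian manifolds -/

section Riemannian

instance (x : M) : FiniteDimensional ℝ (TangentSpace (𝓡 m) x) :=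
  inferInstanceAs (FiniteDimensional ℝ (EuclideanSpace ℝ (Fin m)))

variable [RiemannianBundle (fun x : M => TangentSpace (𝓡 m) x)]

instance (x : M) : Fact (Module.finrank ℝ (TangentSpace (𝓡 m) x) = m) :=
  ⟨finrank_euclideanSpace_fin (𝕜 := ℝ) (n := m)⟩

/-- The star operator on forms, defined pointwise. -/
def starForm (o : ManifoldOrientation m M) {p q : ℕ} (h : p + q = m) (u : Form m M p) :
    Form m M q :=
  fun x => hodgeStar (o.orient x) h (u x)

/-- The operator `d^⋆ = (-1)^{m(p+1)+1} ⋆ d ⋆` on `p`-forms, `p = k + 1`. For `p > m` there are no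
nonzero `p`-forms, and it is `0`. -/
def coDer (o : ManifoldOrientation m M) (k : ℕ) (v : Form m M (k + 1)) : Form m M k :=
  if h : k + 1 ≤ m then
    (-1 : ℝ) ^ (m * ((k + 1) + 1) + 1) •
      starForm o (p := m - (k + 1) + 1) (q := k) (by omega)
        (extDer (starForm o (p := k + 1) (q := m - (k + 1)) (by omega) v))
  else 0

variable [IsManifold (𝓡 m) ∞ M] [T2Space M] [SecondCountableTopology M]

/-- The inner product `⟪u, v⟫ = ∫_M ⟨u, v⟩ dV` of compactly supported `p`-forms. -/
def l2Inner (o : ManifoldOrientation m M) {p : ℕ} (u v : Form m M p) : ℝ :=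
  formIntegral o fun x => formInner (u x) (v x) • volForm (o.orient x)

/-- `T` is a linear map `E^p(M) → E^{p'}(M)`. -/
structure IsLinearOnSmoothForms {p p' : ℕ} (T : Form m M p → Form m M p') : Prop where
  smooth : ∀ u, IsSmoothForm u → IsSmoothForm (T u)
  add : ∀ u v, IsSmoothForm u → IsSmoothForm v → T (u + v) = T u + T v
  smul : ∀ (c : ℝ) (u), IsSmoothForm u → T (c • u) = c • T u

/-- `T'` is the formal adjoint of `T`. -/
structure IsFormalAdjoint (o : ManifoldOrientation m M) {p p' : ℕ}
    (T : Form m M p → Form m M p') (T' : Form m M p' → Form m M p) : Prop where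
  linear : IsLinearOnSmoothForms T
  linear_adjoint : IsLinearOnSmoothForms T'
  l2Inner_eq : ∀ (u : Form m M p) (v : Form m M p'),
    IsSmoothForm u → IsCompactlySupported u → IsSmoothForm v → IsCompactlySupported v →
      l2Inner o (T u) v = l2Inner o u (T' v)

end Riemannian

end Manifold

end RiemannianForms

end

/-!
The theorem is Stokes' theorem for `u ∧ ⋆v`, a form of degree `m - 1`, combined with the pointwise
identities `⟨a, v⟩ dV = a ∧ ⋆v` and `⋆⋆ = (-1)^{p(m-p)}` on `p`-forms. For `w = ⋆v` the two
identities turn `⟨du, v⟩ dV` into `du ∧ w` and `⟨u, d^⋆v⟩ dV` into `(-1)^{k+1} u ∧ dw`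
(`topCoeff_innerForm`, `starForm_coDer`), so the claim is that `du ∧ w + (-1)^k u ∧ dw` has
integral zero. Here the metric has disappeared.

*Localization.* Write `u = ∑ ρ_β u` with the partition of unity. Both sides are additive in `u`
(`formIntegral_add`), hence `u` may be supported in a compact subset of one chart. The integral of
an `m`-form supported in a chart can be computed in that chart alone
(`formIntegral_eq_chartIntegral`), by the change of variables formula
(`chartIntegral_eq_of_support`).

*Stokes in a chart.* In coordinates `dω = ∑ dx_i ∧ ∂_i ω`. As
`(dx_i ∧ a) ∧ b = (-1)^k a ∧ (dx_i ∧ b)` (`wedge_covWedge_left`), the integrand is the sum of the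
partial derivatives `∂_i` of the coefficients of `dx_i ∧ u ∧ w`, and each of them has compact
support (`setIntegral_stokes`). In this way neither the associativity of the exterior product nor
the Leibniz rule for `d` on general products is needed. The sign of the chart is locally constant,
so it does not interfere with the derivatives.

*Smoothness.* `d` maps smooth forms to smooth forms because it can be computed in any chart, by
naturality under coordinate changes (`inChart_extDer`). The star operator is defined through
orthonormal bases which do not depend smoothly on the point, so it is rewritten in the coordinate
frame: indices are raised with the inverse Gram matrix and the volume form of the frame is the sign
of the chart times the square root of the Gram determinant (`hodgeStar_apply_basis`,
`inChart_starForm`).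
-/

noncomputable section

namespace RiemannianForms

/-! ### Exterior products with covectors -/

section LinearAlgebra

variable {V : Type*} [NormedAddCommGroup V] [InnerProductSpace ℝ V]
variable {m p q : ℕ}

@[simp] theorem sumEquiv_inl_val (h : p + q = m) (i : Fin p) :
    (sumEquiv h (Sum.inl i) : ℕ) = i := by
  simp [sumEquiv]

@[simp] theorem sumEquiv_inr_val (h : p + q = m) (i : Fin q) :
    (sumEquiv h (Sum.inr i) : ℕ) = p + i := by
  simp [sumEquiv]

/-- The exterior product is a sum over shuffles; the sum over all permutations counts each shuffle
`p! q!` times. -/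
theorem wedge_eq_sum_perm (h : p + q = m) (α : V [⋀^Fin p]→L[ℝ] ℝ) (β : V [⋀^Fin q]→L[ℝ] ℝ)
    (v : Fin m → V) :
    (p.factorial * q.factorial : ℝ) * wedge h α β v =
      ∑ σ : Equiv.Perm (Fin m), ((Equiv.Perm.sign σ : ℤ) : ℝ) *
        (α (fun i => v (σ (sumEquiv h (Sum.inl i)))) *
          β (fun i => v (σ (sumEquiv h (Sum.inr i))))) := by
  have key := congrArg (fun f => LinearMap.mul' ℝ ℝ (f (fun i => v (sumEquiv h i))))
    (MultilinearMap.domCoprod_alternization_eq α.toAlternatingMap β.toAlternatingMap)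
  simp only [MultilinearMap.alternatization_apply, map_sum, Fintype.card_fin,
    AlternatingMap.smul_apply, map_nsmul] at key
  rw [nsmul_eq_mul] at key
  push_cast at key
  have hw : wedge h α β v = LinearMap.mul' ℝ ℝ
      ((α.toAlternatingMap.domCoprod β.toAlternatingMap) (fun i => v (sumEquiv h i))) := rfl
  rw [hw, ← key, ← Equiv.sum_comp (Equiv.permCongr (sumEquiv h))]
  refine Finset.sum_congr rfl fun σ _ => ?_
  rw [Units.smul_def, map_zsmul, zsmul_eq_mul, Equiv.Perm.sign_permCongr]
  simp only [Equiv.permCongr_apply, Equiv.symm_apply_apply]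
  rfl

theorem wedge_compContinuousLinearMap {W : Type*} [NormedAddCommGroup W] [InnerProductSpace ℝ W]
    (h : p + q = m) (L : W →L[ℝ] V) (α : V [⋀^Fin p]→L[ℝ] ℝ) (β : V [⋀^Fin q]→L[ℝ] ℝ)
    (w : Fin m → W) :
    wedge h (α.compContinuousLinearMap L) (β.compContinuousLinearMap L) w =
      wedge h α β (fun i => L (w i)) := by
  have hne : (p.factorial * q.factorial : ℝ) ≠ 0 := by positivity
  apply mul_left_cancel₀ hne
  rw [wedge_eq_sum_perm, wedge_eq_sum_perm]
  rfl

variable (V) in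
/-- The exterior product of forms of complementary degrees `p` and `q`, evaluated at a fixed tuple
of `m` vectors, as a continuous bilinear map. -/
def wedgePairing (h : p + q = m) (v : Fin m → V) :
    (V [⋀^Fin p]→L[ℝ] ℝ) →L[ℝ] (V [⋀^Fin q]→L[ℝ] ℝ) →L[ℝ] ℝ :=
  (p.factorial * q.factorial : ℝ)⁻¹ • ∑ σ : Equiv.Perm (Fin m),
    ((Equiv.Perm.sign σ : ℤ) : ℝ) • (ContinuousLinearMap.mul ℝ ℝ).bilinearComp
      (ContinuousAlternatingMap.apply ℝ V ℝ fun i => v (σ (sumEquiv h (Sum.inl i))))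
      (ContinuousAlternatingMap.apply ℝ V ℝ fun i => v (σ (sumEquiv h (Sum.inr i))))

theorem wedgePairing_apply (h : p + q = m) (v : Fin m → V) (α : V [⋀^Fin p]→L[ℝ] ℝ)
    (β : V [⋀^Fin q]→L[ℝ] ℝ) : wedgePairing V h v α β = wedge h α β v := by
  have hne : (p.factorial * q.factorial : ℝ) ≠ 0 := by positivity
  apply mul_left_cancel₀ hne
  rw [wedge_eq_sum_perm, wedgePairing]
  simp only [_root_.smul_apply, _root_.sum_apply, ContinuousLinearMap.bilinearComp_apply,
    ContinuousLinearMap.mul_apply', ContinuousAlternatingMap.apply_apply, smul_eq_mul]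
  rw [mul_inv_cancel_left₀ hne]

/-- The exterior product `ℓ ∧ a` of a covector and a `p`-form, normalized as in `extDeriv`. -/
def covWedge (l : V →L[ℝ] ℝ) (a : V [⋀^Fin p]→L[ℝ] ℝ) : V [⋀^Fin (p + 1)]→L[ℝ] ℝ :=
  ContinuousAlternatingMap.alternatizeUncurryFin (l.smulRight a)

theorem covWedge_apply (l : V →L[ℝ] ℝ) (a : V [⋀^Fin p]→L[ℝ] ℝ) (v : Fin (p + 1) → V) :
    covWedge l a v = ∑ i : Fin (p + 1),
      (-1 : ℝ) ^ (i : ℕ) * (l (v i) * a (fun j => v (i.succAbove j))) := by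
  rw [covWedge, ContinuousAlternatingMap.alternatizeUncurryFin_apply]
  refine Finset.sum_congr rfl fun i _ => ?_
  simp only [ContinuousLinearMap.smulRight_apply, ContinuousAlternatingMap.smul_apply, smul_eq_mul,
    zsmul_eq_mul]
  push_cast
  rfl

theorem sum_perm_sign_mul {ι : Type*} [Fintype ι] [DecidableEq ι] (c : Equiv.Perm ι)
    (F : Equiv.Perm ι → ℝ) :
    ∑ σ : Equiv.Perm ι, ((Equiv.Perm.sign σ : ℤ) : ℝ) * F (σ * c) =
      ((Equiv.Perm.sign c : ℤ) : ℝ) * ∑ σ : Equiv.Perm ι, ((Equiv.Perm.sign σ : ℤ) : ℝ) * F σ := by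
  rw [← Equiv.sum_comp (Equiv.mulRight c) (fun σ => ((Equiv.Perm.sign σ : ℤ) : ℝ) * F σ),
    Finset.mul_sum]
  refine Finset.sum_congr rfl fun σ _ => ?_
  have hsq : ((Equiv.Perm.sign c : ℤ) : ℝ) * ((Equiv.Perm.sign c : ℤ) : ℝ) = 1 := by
    rcases Int.units_eq_one_or (Equiv.Perm.sign c) with h | h <;> simp [h]
  simp only [Equiv.coe_mulRight, Equiv.Perm.sign_mul, Units.val_mul, Int.cast_mul]
  linear_combination (-((Equiv.Perm.sign σ : ℤ) : ℝ) * F (σ * c)) * hsq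

theorem sign_cycleRange_cast {n : ℕ} (i : Fin n) :
    ((Equiv.Perm.sign (Fin.cycleRange i) : ℤ) : ℝ) = (-1) ^ (i : ℕ) := by
  rw [Fin.sign_cycleRange]; push_cast; rfl

/-- The alternation inside `ℓ ∧ a` is absorbed by the alternation of the outer product: the term in
which `ℓ` takes the `i`-th vector becomes the term `i = 0` after a cycle inside the first block,
and the cycle has the sign of the term. -/
theorem covWedge_wedge_eq_sum (h : p + 1 + q = m) (l : V →L[ℝ] ℝ) (a : V [⋀^Fin p]→L[ℝ] ℝ)
    (b : V [⋀^Fin q]→L[ℝ] ℝ) (v : Fin m → V) :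
    (p.factorial * q.factorial : ℝ) * wedge h (covWedge l a) b v =
      ∑ σ : Equiv.Perm (Fin m), ((Equiv.Perm.sign σ : ℤ) : ℝ) *
        (l (v (σ (sumEquiv h (Sum.inl 0)))) * a (fun i => v (σ (sumEquiv h (Sum.inl i.succ)))) *
          b (fun i => v (σ (sumEquiv h (Sum.inr i))))) := by
  have hne : ((p + 1 : ℕ) : ℝ) ≠ 0 := by positivity
  apply mul_left_cancel₀ hne
  have := wedge_eq_sum_perm h (covWedge l a) b v
  rw [Nat.factorial_succ] at this
  push_cast at this ⊢
  rw [← mul_assoc, ← mul_assoc, this]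
  set F : Equiv.Perm (Fin m) → ℝ := fun σ =>
    (l (v (σ (sumEquiv h (Sum.inl 0)))) * a (fun i => v (σ (sumEquiv h (Sum.inl i.succ)))) *
          b (fun i => v (σ (sumEquiv h (Sum.inr i))))) with hF
  let c : Fin (p + 1) → Equiv.Perm (Fin m) := fun i =>
    (sumEquiv h).permCongr (Equiv.sumCongr (Fin.cycleRange i) (Equiv.refl _))
  have hc : ∀ i, ((Equiv.Perm.sign (c i) : ℤ) : ℝ) = (-1) ^ (i : ℕ) := by
    intro i
    rw [← sign_cycleRange_cast]
    simp only [c, Equiv.Perm.sign_permCongr, Equiv.Perm.sign_sumCongr]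
    simp
  have hsum : ∀ i : Fin (p + 1), ∑ σ : Equiv.Perm (Fin m), ((Equiv.Perm.sign σ : ℤ) : ℝ) *
      ((-1) ^ (i : ℕ) * F (σ * (c i)⁻¹)) =
        ∑ σ : Equiv.Perm (Fin m), ((Equiv.Perm.sign σ : ℤ) : ℝ) * F σ := by
    intro i
    rw [sum_perm_sign_mul (c i)⁻¹ (fun σ => (-1) ^ (i : ℕ) * F σ), Equiv.Perm.sign_inv, hc,
      Finset.mul_sum]
    refine Finset.sum_congr rfl fun σ _ => ?_
    have : ((-1 : ℝ) ^ (i : ℕ)) * (-1) ^ (i : ℕ) = 1 := by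
      rw [← mul_pow]; simp
    linear_combination (((Equiv.Perm.sign σ : ℤ) : ℝ) * F σ) * this
  trans ∑ i : Fin (p + 1), ∑ σ : Equiv.Perm (Fin m), ((Equiv.Perm.sign σ : ℤ) : ℝ) * F σ
  · rw [← Finset.sum_congr rfl fun i _ => hsum i, Finset.sum_comm]
    refine Finset.sum_congr rfl fun σ _ => ?_
    rw [covWedge_apply, Finset.sum_mul, Finset.mul_sum]
    refine Finset.sum_congr rfl fun i _ => ?_
    have h0 : (c i)⁻¹ (sumEquiv h (Sum.inl 0)) = sumEquiv h (Sum.inl i) := by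
      rw [Equiv.Perm.inv_eq_iff_eq]; simp [c]
    have h1 : ∀ j : Fin p, (c i)⁻¹ (sumEquiv h (Sum.inl j.succ)) =
        sumEquiv h (Sum.inl (i.succAbove j)) := by
      intro j; rw [Equiv.Perm.inv_eq_iff_eq]; simp [c, Fin.cycleRange_succAbove]
    have h2 : ∀ j : Fin q, (c i)⁻¹ (sumEquiv h (Sum.inr j)) = sumEquiv h (Sum.inr j) := by
      intro j; rw [Equiv.Perm.inv_eq_iff_eq]; simp [c]
    simp only [hF, Equiv.Perm.mul_apply, h0, h1, h2]
    ring
  · simp [hF]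

/-- The analogue of `covWedge_wedge_eq_sum` for cycles inside the second block. -/
theorem wedge_covWedge_eq_sum (h : p + (q + 1) = m) (l : V →L[ℝ] ℝ) (a : V [⋀^Fin p]→L[ℝ] ℝ)
    (b : V [⋀^Fin q]→L[ℝ] ℝ) (v : Fin m → V) :
    (p.factorial * q.factorial : ℝ) * wedge h a (covWedge l b) v =
      ∑ σ : Equiv.Perm (Fin m), ((Equiv.Perm.sign σ : ℤ) : ℝ) *
        (l (v (σ (sumEquiv h (Sum.inr 0)))) * a (fun i => v (σ (sumEquiv h (Sum.inl i)))) *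
          b (fun i => v (σ (sumEquiv h (Sum.inr i.succ))))) := by
  have hne : ((q + 1 : ℕ) : ℝ) ≠ 0 := by positivity
  apply mul_left_cancel₀ hne
  have := wedge_eq_sum_perm h a (covWedge l b) v
  rw [Nat.factorial_succ] at this
  push_cast at this ⊢
  rw [← mul_assoc, mul_left_comm, this]
  set F : Equiv.Perm (Fin m) → ℝ := fun σ =>
    (l (v (σ (sumEquiv h (Sum.inr 0)))) * a (fun i => v (σ (sumEquiv h (Sum.inl i)))) *
          b (fun i => v (σ (sumEquiv h (Sum.inr i.succ))))) with hF
  let c : Fin (q + 1) → Equiv.Perm (Fin m) := fun i =>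
    (sumEquiv h).permCongr (Equiv.sumCongr (Equiv.refl _) (Fin.cycleRange i))
  have hc : ∀ i, ((Equiv.Perm.sign (c i) : ℤ) : ℝ) = (-1) ^ (i : ℕ) := by
    intro i
    rw [← sign_cycleRange_cast]
    simp only [c, Equiv.Perm.sign_permCongr, Equiv.Perm.sign_sumCongr]
    simp
  have hsum : ∀ i : Fin (q + 1), ∑ σ : Equiv.Perm (Fin m), ((Equiv.Perm.sign σ : ℤ) : ℝ) *
      ((-1) ^ (i : ℕ) * F (σ * (c i)⁻¹)) =
        ∑ σ : Equiv.Perm (Fin m), ((Equiv.Perm.sign σ : ℤ) : ℝ) * F σ := by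
    intro i
    rw [sum_perm_sign_mul (c i)⁻¹ (fun σ => (-1) ^ (i : ℕ) * F σ), Equiv.Perm.sign_inv, hc,
      Finset.mul_sum]
    refine Finset.sum_congr rfl fun σ _ => ?_
    have : ((-1 : ℝ) ^ (i : ℕ)) * (-1) ^ (i : ℕ) = 1 := by
      rw [← mul_pow]; simp
    linear_combination (((Equiv.Perm.sign σ : ℤ) : ℝ) * F σ) * this
  trans ∑ i : Fin (q + 1), ∑ σ : Equiv.Perm (Fin m), ((Equiv.Perm.sign σ : ℤ) : ℝ) * F σ
  · rw [← Finset.sum_congr rfl fun i _ => hsum i, Finset.sum_comm]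
    refine Finset.sum_congr rfl fun σ _ => ?_
    rw [covWedge_apply, Finset.mul_sum, Finset.mul_sum]
    refine Finset.sum_congr rfl fun i _ => ?_
    have h0 : (c i)⁻¹ (sumEquiv h (Sum.inr 0)) = sumEquiv h (Sum.inr i) := by
      rw [Equiv.Perm.inv_eq_iff_eq]; simp [c]
    have h1 : ∀ j : Fin q, (c i)⁻¹ (sumEquiv h (Sum.inr j.succ)) =
        sumEquiv h (Sum.inr (i.succAbove j)) := by
      intro j; rw [Equiv.Perm.inv_eq_iff_eq]; simp [c, Fin.cycleRange_succAbove]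
    have h2 : ∀ j : Fin p, (c i)⁻¹ (sumEquiv h (Sum.inl j)) = sumEquiv h (Sum.inl j) := by
      intro j; rw [Equiv.Perm.inv_eq_iff_eq]; simp [c]
    simp only [hF, Equiv.Perm.mul_apply, h0, h1, h2]
    ring
  · simp [hF]

/-- Moving a covector across a `p`-form in an exterior product costs the sign `(-1)^p`. -/
theorem wedge_covWedge_left (h₁ : p + 1 + q = m) (h₂ : p + (q + 1) = m) (l : V →L[ℝ] ℝ)
    (a : V [⋀^Fin p]→L[ℝ] ℝ) (b : V [⋀^Fin q]→L[ℝ] ℝ) (v : Fin m → V) :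
    wedge h₁ (covWedge l a) b v = (-1) ^ p * wedge h₂ a (covWedge l b) v := by
  have hne : (p.factorial * q.factorial : ℝ) ≠ 0 := by positivity
  apply mul_left_cancel₀ hne
  rw [covWedge_wedge_eq_sum, mul_left_comm, wedge_covWedge_eq_sum]
  -- the cycle which moves the position `p` to the front
  let c : Equiv.Perm (Fin m) := Fin.cycleRange ⟨p, by omega⟩
  set F : Equiv.Perm (Fin m) → ℝ := fun σ =>
    (l (v (σ (sumEquiv h₂ (Sum.inr 0)))) * a (fun i => v (σ (sumEquiv h₂ (Sum.inl i)))) *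
      b (fun i => v (σ (sumEquiv h₂ (Sum.inr i.succ))))) with hF
  have h0 : c (sumEquiv h₂ (Sum.inr 0)) = sumEquiv h₁ (Sum.inl 0) := by
    obtain ⟨n, rfl⟩ : ∃ n, m = n + 1 := ⟨p + q, by omega⟩
    have : sumEquiv h₂ (Sum.inr 0) = ⟨p, by omega⟩ := by ext; simp
    rw [this]; ext; simp [c]
  have h1 : ∀ j : Fin p, c (sumEquiv h₂ (Sum.inl j)) = sumEquiv h₁ (Sum.inl j.succ) := by
    intro j
    ext
    simp only [c]
    rw [Fin.coe_cycleRange_of_lt]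
    · simp
    · rw [Fin.lt_def]; simp
  have h2 : ∀ j : Fin q, c (sumEquiv h₂ (Sum.inr j.succ)) = sumEquiv h₁ (Sum.inr j) := by
    intro j
    simp only [c]
    rw [Fin.cycleRange_of_gt]
    · ext; simp; omega
    · rw [Fin.lt_def]; simp
  have := sum_perm_sign_mul c F
  rw [show ((Equiv.Perm.sign c : ℤ) : ℝ) = (-1) ^ p from sign_cycleRange_cast _] at this
  simp only [hF, Equiv.Perm.mul_apply, h0, h1, h2] at this
  rw [this]

end LinearAlgebra

/-! ### Algebra of the star operator -/

section LinearAlgebra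

/-- The block transposition `(1, …, q, q + 1, …, q + p) ↦ (p + 1, …, p + q, 1, …, p)` is the `p`-th
power of the cyclic rotation, so its sign is `(-1)^{pq}`. -/
theorem sign_sumComm_sumEquiv {m p q : ℕ} (h : p + q = m) (h' : q + p = m) :
    Equiv.Perm.sign (((sumEquiv h').symm.trans (Equiv.sumComm _ _)).trans (sumEquiv h)) =
      (-1) ^ (p * q) := by
  rcases m with _ | n
  · obtain rfl : p = 0 := by omega
    rw [Subsingleton.elim (((sumEquiv h').symm.trans (Equiv.sumComm _ _)).trans (sumEquiv h)) 1]
    simp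
  have hpow : ∀ (r : ℕ) (x : Fin (n + 1)), ((finRotate (n + 1) ^ r) x : ℕ) = (x + r) % (n + 1) := by
    intro r
    induction r with
    | zero => intro x; simp [Nat.mod_eq_of_lt x.2]
    | succ r ih =>
      intro x
      rw [pow_succ', Equiv.Perm.mul_apply, finRotate_apply, Fin.val_add, ih]
      simp [add_assoc]
  have heq : ((sumEquiv h').symm.trans (Equiv.sumComm _ _)).trans (sumEquiv h) =
      finRotate (n + 1) ^ p := by
    ext x
    obtain ⟨y, rfl⟩ := (sumEquiv h').surjective x
    rw [hpow]
    rcases y with i | i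
    · simp only [Equiv.trans_apply, Equiv.symm_apply_apply, Equiv.sumComm_apply, Sum.swap_inl,
        sumEquiv_inr_val, sumEquiv_inl_val]
      rw [Nat.mod_eq_of_lt (by omega), add_comm]
    · simp only [Equiv.trans_apply, Equiv.symm_apply_apply, Equiv.sumComm_apply, Sum.swap_inr,
        sumEquiv_inr_val, sumEquiv_inl_val]
      rw [show q + (i : ℕ) + p = i + (n + 1) by omega, Nat.add_mod_right,
        Nat.mod_eq_of_lt (by omega)]
  rw [heq, map_pow, sign_finRotate, ← pow_mul]
  rcases p with _ | r
  · simp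
  obtain rfl : n = r + q := by omega
  rw [show (r + q + 1 - 1) * (r + 1) = r * (r + 1) + (r + 1) * q by simp; ring, pow_add,
    Even.neg_one_pow (Nat.even_mul_succ_self r), one_mul]

theorem alternating_elim_swap {W : Type*} [AddCommGroup W] [Module ℝ W] {m p q : ℕ}
    (h : p + q = m) (h' : q + p = m) (f : W [⋀^Fin m]→ₗ[ℝ] ℝ) (a : Fin p → W) (b : Fin q → W) :
    f (Sum.elim b a ∘ (sumEquiv h').symm) =
      (-1) ^ (p * q) * f (Sum.elim a b ∘ (sumEquiv h).symm) := by
  have : Sum.elim b a ∘ (sumEquiv h').symm = (Sum.elim a b ∘ (sumEquiv h).symm) ∘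
      (((sumEquiv h').symm.trans (Equiv.sumComm _ _)).trans (sumEquiv h)) := by
    funext x
    obtain ⟨y, rfl⟩ := (sumEquiv h').surjective x
    rcases y with i | i <;> simp
  rw [this, AlternatingMap.map_perm, sign_sumComm_sumEquiv]
  simp [Units.smul_def]

/-- An injective map `Fin p → Fin n` factors uniquely as an increasing map after a permutation. -/
theorem exists_orderEmbedding_comp_perm {p n : ℕ} {f : Fin p → Fin n}
    (hf : Function.Injective f) :
    ∃ (I : Fin p ↪o Fin n) (σ : Equiv.Perm (Fin p)), f = I ∘ σ := by
  have hs : StrictMono (f ∘ Tuple.sort f) :=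
    (Tuple.monotone_sort f).strictMono_of_injective (hf.comp (Tuple.sort f).injective)
  refine ⟨OrderEmbedding.ofStrictMono _ hs, (Tuple.sort f)⁻¹, ?_⟩
  funext x
  simp

theorem orderEmbedding_eq_of_range_eq {p n : ℕ} {I J : Fin p ↪o Fin n}
    (h : Set.range I = Set.range J) : I = J :=
  DFunLike.ext' ((StrictMono.range_inj I.strictMono J.strictMono).1 h)

variable {V : Type*} [NormedAddCommGroup V] [InnerProductSpace ℝ V]
variable {m p q n : ℕ}

theorem ext_of_orderEmbedding (b : Module.Basis (Fin n) ℝ V) {α β : V [⋀^Fin p]→L[ℝ] ℝ}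
    (h : ∀ I : Fin p ↪o Fin n, α (b ∘ I) = β (b ∘ I)) : α = β := by
  apply ContinuousAlternatingMap.toAlternatingMap_injective
  refine Module.Basis.ext_alternating b fun f hf => ?_
  obtain ⟨I, σ, rfl⟩ := exists_orderEmbedding_comp_perm hf
  have := h I
  have h1 := α.toAlternatingMap.map_perm (b ∘ I) σ
  have h2 := β.toAlternatingMap.map_perm (b ∘ I) σ
  have h3 : α.toAlternatingMap (b ∘ I) = β.toAlternatingMap (b ∘ I) := this
  rw [h3, ← h2] at h1
  exact h1

/-- A product of two alternating functions of the same vectors is symmetric, so its sum over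
increasing indices is `1 / p!` of the sum over all indices. -/
theorem factorial_mul_sum_orderEmbedding (e : Fin n → V) (Φ Ψ : V [⋀^Fin p]→ₗ[ℝ] ℝ) :
    (p.factorial : ℝ) * ∑ I : Fin p ↪o Fin n, Φ (e ∘ I) * Ψ (e ∘ I) =
      ∑ f : Fin p → Fin n, Φ (e ∘ f) * Ψ (e ∘ f) := by
  trans ∑ x : (Fin p ↪o Fin n) × Equiv.Perm (Fin p), Φ (e ∘ x.1) * Ψ (e ∘ x.1)
  · rw [Fintype.sum_prod_type]
    simp [Fintype.card_perm, Finset.mul_sum]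
  refine Fintype.sum_of_injective (fun x => x.1 ∘ x.2) ?_ _ _ ?_ ?_
  · rintro ⟨I, σ⟩ ⟨J, τ⟩ hIJ
    have hIJ' : I ∘ σ = J ∘ τ := hIJ
    have hr : I = J := by
      apply orderEmbedding_eq_of_range_eq
      rw [← σ.surjective.range_comp I, ← τ.surjective.range_comp J, hIJ']
    subst hr
    have : σ = τ := by
      ext1 x
      exact I.injective (congrFun hIJ' x)
    rw [this]
  · intro f hf
    have hni : ¬ Function.Injective f := by
      intro hinj
      obtain ⟨I, σ, rfl⟩ := exists_orderEmbedding_comp_perm hinj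
      exact hf ⟨(I, σ), rfl⟩
    obtain ⟨i, j, hij, hne⟩ : ∃ i j, f i = f j ∧ i ≠ j := by
      simpa [Function.Injective] using hni
    rw [Φ.map_eq_zero_of_eq (e ∘ f) (i := i) (j := j) (by simp [hij]) hne, zero_mul]
  · rintro ⟨I, σ⟩
    have h1 := Φ.map_perm (e ∘ I) σ
    have h2 := Ψ.map_perm (e ∘ I) σ
    have hsq : ((Equiv.Perm.sign σ : ℤ) : ℝ) * ((Equiv.Perm.sign σ : ℤ) : ℝ) = 1 := by
      rcases Int.units_eq_one_or (Equiv.Perm.sign σ) with h | h <;> simp [h]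
    rw [Units.smul_def, zsmul_eq_mul] at h1 h2
    change _ = Φ ((e ∘ I) ∘ σ) * Ψ ((e ∘ I) ∘ σ)
    rw [h1, h2]
    linear_combination (-(Φ (e ∘ I) * Ψ (e ∘ I))) * hsq

/-- The change of basis formula for a full contraction of two multilinear functions. -/
theorem sum_mul_comp_basis (e : Fin n → V) (b : Fin m → V) (A : Fin n → Fin m → ℝ)
    (hA : ∀ i, e i = ∑ j, A i j • b j) (Φ Ψ : MultilinearMap ℝ (fun _ : Fin p => V) ℝ) :
    ∑ f : Fin p → Fin n, Φ (e ∘ f) * Ψ (e ∘ f) =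
      ∑ g : Fin p → Fin m, ∑ h : Fin p → Fin m,
        (∏ k, ∑ i, A i (g k) * A i (h k)) * (Φ (b ∘ g) * Ψ (b ∘ h)) := by
  have expand : ∀ (X : MultilinearMap ℝ (fun _ : Fin p => V) ℝ) (f : Fin p → Fin n),
      X (e ∘ f) = ∑ g : Fin p → Fin m, (∏ k, A (f k) (g k)) * X (b ∘ g) := by
    intro X f
    have : e ∘ f = fun k => ∑ j, A (f k) j • b j := by funext k; simp [hA]
    rw [this, MultilinearMap.map_sum]
    refine Finset.sum_congr rfl fun g _ => ?_
    rw [X.map_smul_univ, smul_eq_mul]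
    rfl
  have hprod : ∀ g h : Fin p → Fin m, (∏ k, ∑ i, A i (g k) * A i (h k)) =
      ∑ f : Fin p → Fin n, ∏ k, (A (f k) (g k) * A (f k) (h k)) := by
    intro g h
    rw [Finset.prod_univ_sum, Fintype.piFinset_univ]
  simp_rw [expand, hprod, Finset.sum_mul_sum, Finset.sum_mul]
  rw [Finset.sum_comm]
  refine Finset.sum_congr rfl fun g _ => ?_
  rw [Finset.sum_comm]
  refine Finset.sum_congr rfl fun h _ => Finset.sum_congr rfl fun f _ => ?_
  rw [Finset.prod_mul_distrib]
  ring

variable [FiniteDimensional ℝ V] [Fact (Module.finrank ℝ V = m)]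

theorem hodgeStar_apply (o : Orientation ℝ V (Fin m)) (h : p + q = m) (v : V [⋀^Fin p]→L[ℝ] ℝ)
    (w : Fin q → V) :
    hodgeStar o h v w = ∑ I : Fin p ↪o Fin (Module.finrank ℝ V),
      v (stdOrthonormalBasis ℝ V ∘ I) *
        o.volumeForm (Sum.elim (stdOrthonormalBasis ℝ V ∘ I) w ∘ (sumEquiv h).symm) := by
  rw [hodgeStar, ContinuousAlternatingMap.sum_apply]
  rfl

theorem hodgeStar_add (o : Orientation ℝ V (Fin m)) (h : p + q = m) (u v : V [⋀^Fin p]→L[ℝ] ℝ) :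
    hodgeStar o h (u + v) = hodgeStar o h u + hodgeStar o h v := by
  simp only [hodgeStar, ← Finset.sum_add_distrib, ← add_smul]
  rfl

theorem hodgeStar_smul (o : Orientation ℝ V (Fin m)) (h : p + q = m) (c : ℝ)
    (v : V [⋀^Fin p]→L[ℝ] ℝ) :
    hodgeStar o h (c • v) = c • hodgeStar o h v := by
  simp only [hodgeStar, Finset.smul_sum, smul_smul]
  rfl

omit [FiniteDimensional ℝ V] in
/-- The matrix `dV(e_I, e_J)`, `|I| = p` and `|J| = q` increasing, is up to signs the permutation
matrix of `I ↦ CI`, so it has orthonormal rows. -/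
theorem sum_volumeForm_mul_volumeForm (e : OrthonormalBasis (Fin m) ℝ V)
    (o : Orientation ℝ V (Fin m)) (h : p + q = m) (I K : Fin p ↪o Fin m) :
    ∑ J : Fin q ↪o Fin m, o.volumeForm (Sum.elim (e ∘ I) (e ∘ J) ∘ (sumEquiv h).symm) *
      o.volumeForm (Sum.elim (e ∘ K) (e ∘ J) ∘ (sumEquiv h).symm) = if I = K then 1 else 0 := by
  have hzero : ∀ (I : Fin p ↪o Fin m) (J : Fin q ↪o Fin m),
      o.volumeForm (Sum.elim (e ∘ I) (e ∘ J) ∘ (sumEquiv h).symm) ≠ 0 →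
        Set.range J = (Set.range I)ᶜ := by
    intro I J hIJ
    have hdisj : ∀ i j, I i ≠ J j := by
      intro i j hij
      apply hIJ
      refine o.volumeForm.map_eq_zero_of_eq _ (i := sumEquiv h (Sum.inl i))
        (j := sumEquiv h (Sum.inr j)) ?_ ?_
      · simp [hij]
      · simp
    have hinj : Function.Injective (Sum.elim I J) := by
      rw [Sum.elim_injective]
      exact ⟨I.injective, J.injective, hdisj⟩
    have hbij : Function.Bijective (Sum.elim I J) := by
      rw [Fintype.bijective_iff_injective_and_card]
      exact ⟨hinj, by simp [h]⟩
    ext x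
    constructor
    · rintro ⟨j, rfl⟩ ⟨i, hi⟩
      exact hdisj i j hi
    · intro hx
      obtain ⟨y | y, hy⟩ := hbij.surjective x
      · exact absurd ⟨y, hy⟩ hx
      · exact ⟨y, hy⟩
  split_ifs with hIK
  · subst hIK
    have h1 : (Finset.univ.map I.toEmbedding).card = p := by simp
    have h2 : (Finset.univ.map I.toEmbedding)ᶜ.card = q := by
      rw [Finset.card_compl, h1]; simp; omega
    set J₀ := (Finset.univ.map I.toEmbedding)ᶜ.orderEmbOfFin h2 with hJ₀
    have hr : Set.range J₀ = (Set.range I)ᶜ := by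
      rw [hJ₀, Finset.range_orderEmbOfFin]
      ext x; simp
    have hbij : Function.Bijective (Sum.elim I J₀) := by
      rw [Fintype.bijective_iff_injective_and_card]
      refine ⟨?_, by simp [h]⟩
      rw [Sum.elim_injective]
      refine ⟨I.injective, J₀.injective, fun i j hij => ?_⟩
      have : J₀ j ∈ (Set.range I)ᶜ := hr ▸ ⟨j, rfl⟩
      exact this ⟨i, hij⟩
    rw [Finset.sum_eq_single J₀]
    · let τ : Equiv.Perm (Fin m) := (sumEquiv h).symm.trans (Equiv.ofBijective _ hbij)
      have hτ : Sum.elim (e ∘ I) (e ∘ J₀) ∘ (sumEquiv h).symm = e.reindex τ.symm := by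
        funext x
        obtain ⟨y, rfl⟩ := (sumEquiv h).surjective x
        rcases y with i | i <;> simp [τ]
      rw [hτ, ← abs_mul_abs_self, o.abs_volumeForm_apply_of_orthonormal, one_mul]
    · intro J _ hJ
      by_contra hne
      rw [mul_self_eq_zero] at hne
      exact hJ (orderEmbedding_eq_of_range_eq ((hzero I J hne).trans hr.symm))
    · simp
  · refine Finset.sum_eq_zero fun J _ => ?_
    by_contra hne
    rw [mul_eq_zero, not_or] at hne
    apply hIK
    apply orderEmbedding_eq_of_range_eq
    rw [← compl_inj_iff, ← hzero I J hne.1, ← hzero K J hne.2]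

/-- `⋆⋆ = (-1)^{p(m-p)}` on `p`-forms: in an orthonormal basis the two star operators are, up to
the sign `(-1)^{pq}` of the block transposition, transposes of each other, and the rows of
`sum_volumeForm_mul_volumeForm` are orthonormal. -/
theorem hodgeStar_hodgeStar (o : Orientation ℝ V (Fin m)) (h : p + q = m) (h' : q + p = m)
    (v : V [⋀^Fin p]→L[ℝ] ℝ) : hodgeStar o h' (hodgeStar o h v) = (-1 : ℝ) ^ (p * q) • v := by
  obtain rfl : Module.finrank ℝ V = m := Fact.out
  set e := stdOrthonormalBasis ℝ V with he
  refine ext_of_orderEmbedding e.toBasis fun K => ?_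
  rw [hodgeStar_apply, ContinuousAlternatingMap.smul_apply, smul_eq_mul]
  simp only [hodgeStar_apply, ← he, OrthonormalBasis.coe_toBasis]
  simp only [alternating_elim_swap h h' o.volumeForm, Finset.sum_mul]
  rw [Finset.sum_comm]
  trans ∑ I : Fin p ↪o Fin (Module.finrank ℝ V), (-1 : ℝ) ^ (p * q) * v (e ∘ I) *
    if I = K then 1 else 0
  · refine Finset.sum_congr rfl fun I _ => ?_
    rw [← sum_volumeForm_mul_volumeForm e o h I K, Finset.mul_sum]
    refine Finset.sum_congr rfl fun J _ => ?_
    ring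
  · simp

/-- The Gram matrix of a tuple of vectors. -/
def gramMatrix (b : Fin m → V) : Matrix (Fin m) (Fin m) ℝ :=
  Matrix.of fun i j => inner ℝ (b i) (b j)

omit [FiniteDimensional ℝ V] [Fact (Module.finrank ℝ V = m)] in
theorem gramMatrix_eq_transpose_mul (e : OrthonormalBasis (Fin m) ℝ V) (b : Fin m → V) :
    gramMatrix b = (e.toBasis.toMatrix b).transpose * e.toBasis.toMatrix b := by
  ext i j
  simp only [gramMatrix, Matrix.of_apply, Matrix.mul_apply, Matrix.transpose_apply,
    Module.Basis.toMatrix_apply, OrthonormalBasis.coe_toBasis_repr_apply,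
    OrthonormalBasis.repr_apply_apply]
  rw [← e.sum_inner_mul_inner]
  refine Finset.sum_congr rfl fun k _ => ?_
  rw [real_inner_comm]

/-- The volume form is computed up to sign by the Gram determinant, without an orthonormal basis. -/
theorem det_gramMatrix (o : Orientation ℝ V (Fin m)) (b : Fin m → V) :
    (gramMatrix b).det = o.volumeForm b ^ 2 := by
  obtain rfl : Module.finrank ℝ V = m := Fact.out
  set e := stdOrthonormalBasis ℝ V with he
  rw [gramMatrix_eq_transpose_mul e, Matrix.det_mul, Matrix.det_transpose, ← sq, ← sq_abs,
    ← sq_abs (o.volumeForm b), o.volumeForm_robust' e, Module.Basis.det_apply]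

/-- The star operator in an arbitrary basis: indices are raised with the inverse Gram matrix. -/
theorem hodgeStar_apply_basis (o : Orientation ℝ V (Fin m)) (h : p + q = m)
    (b : Module.Basis (Fin m) ℝ V) (v : V [⋀^Fin p]→L[ℝ] ℝ) (w : Fin q → V) :
    hodgeStar o h v w = (p.factorial : ℝ)⁻¹ * ∑ g : Fin p → Fin m, ∑ g' : Fin p → Fin m,
      (∏ k, (gramMatrix b)⁻¹ (g k) (g' k)) *
        (v (b ∘ g) * volContract o h (b ∘ g') w) := by
  obtain rfl : Module.finrank ℝ V = m := Fact.out
  set e := stdOrthonormalBasis ℝ V with he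
  have hne : (p.factorial : ℝ) ≠ 0 := by positivity
  rw [eq_inv_mul_iff_mul_eq₀ hne, hodgeStar_apply]
  let Ψ : V [⋀^Fin p]→L[ℝ] ℝ := (-1 : ℝ) ^ (q * p) • volContract o (add_comm q p ▸ h) w
  have hΨ : ∀ a : Fin p → V, Ψ a = o.volumeForm (Sum.elim a w ∘ (sumEquiv h).symm) := by
    intro a
    rw [alternating_elim_swap (add_comm q p ▸ h) h]
    rfl
  have h1 := factorial_mul_sum_orderEmbedding e v.toAlternatingMap Ψ.toAlternatingMap
  have hG : (gramMatrix b)⁻¹ = b.toMatrix e * (b.toMatrix e).transpose := by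
    apply Matrix.inv_eq_left_inv
    rw [gramMatrix_eq_transpose_mul e]
    have hbe : b.toMatrix e * e.toBasis.toMatrix b = 1 :=
      b.toMatrix_mul_toMatrix_flip e.toBasis
    have heb : e.toBasis.toMatrix b * b.toMatrix e = 1 :=
      e.toBasis.toMatrix_mul_toMatrix_flip b
    rw [Matrix.mul_assoc, ← Matrix.mul_assoc (b.toMatrix e).transpose, ← Matrix.transpose_mul,
      heb, Matrix.transpose_one, Matrix.one_mul, hbe]
  have h2 := sum_mul_comp_basis e b (fun i j => b.repr (e i) j) (fun i => (b.sum_repr (e i)).symm)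
    v.toAlternatingMap.toMultilinearMap Ψ.toAlternatingMap.toMultilinearMap
  have h3 : ∀ j k, ∑ i, b.repr (e i) j * b.repr (e i) k = (gramMatrix b)⁻¹ j k := by
    intro j k
    rw [hG, Matrix.mul_apply]
    rfl
  simp only [h3] at h2
  have h4 := h1.trans h2
  simp only [← he, ← hΨ]
  refine h4.trans ?_
  refine Finset.sum_congr rfl fun g _ => Finset.sum_congr rfl fun g' _ => ?_
  rw [volContract_apply, ← hΨ]
  rfl

end LinearAlgebra

/-! ### Forms in charts and the exterior derivative -/

section Charts

variable {m : ℕ} {M : Type*} [TopologicalSpace M] [ChartedSpace (EuclideanSpace ℝ (Fin m)) M]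

/-- The derivative of the inverse of the chart at `x₀`, with all tangent spaces identified with
`ℝ^m`. -/
def symmDeriv (x₀ : M) (z : EuclideanSpace ℝ (Fin m)) :
    EuclideanSpace ℝ (Fin m) →L[ℝ] EuclideanSpace ℝ (Fin m) :=
  mfderiv 𝓘(ℝ, EuclideanSpace ℝ (Fin m)) (𝓡 m) (extChartAt (𝓡 m) x₀).symm z

/-- The derivative of the chart at `x₀`, with all tangent spaces identified with `ℝ^m`. -/
def chartDeriv (x₀ x : M) : EuclideanSpace ℝ (Fin m) →L[ℝ] EuclideanSpace ℝ (Fin m) :=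
  mfderiv (𝓡 m) 𝓘(ℝ, EuclideanSpace ℝ (Fin m)) (extChartAt (𝓡 m) x₀) x

/-- The values of a form, with all tangent spaces identified with `ℝ^m`. -/
def flatForm {p : ℕ} (u : Form m M p) (x : M) : (EuclideanSpace ℝ (Fin m)) [⋀^Fin p]→L[ℝ] ℝ := u x

theorem inChart_eq {p : ℕ} (x₀ : M) (u : Form m M p) (z : EuclideanSpace ℝ (Fin m)) :
    inChart x₀ u z = (flatForm u ((extChartAt (𝓡 m) x₀).symm z)).compContinuousLinearMap
      (symmDeriv x₀ z) := rfl

theorem flatForm_extDer {p : ℕ} (u : Form m M p) (x : M) :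
    flatForm (extDer u) x = (extDeriv (inChart x u) (extChartAt (𝓡 m) x x)).compContinuousLinearMap
      (chartDeriv x x) := rfl

theorem inChart_add {p : ℕ} (x₀ : M) (u v : Form m M p) :
    inChart x₀ (u + v) = inChart x₀ u + inChart x₀ v := rfl

theorem inChart_smul {p : ℕ} (x₀ : M) (c : ℝ) (u : Form m M p) :
    inChart x₀ (c • u) = c • inChart x₀ u := rfl

theorem inChart_zero {p : ℕ} (x₀ : M) : inChart x₀ (0 : Form m M p) = 0 := rfl

/-- The coordinate change from the chart at `x₀` to the chart at `x₁`. -/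
def coordChange (x₀ x₁ : M) (z : EuclideanSpace ℝ (Fin m)) : EuclideanSpace ℝ (Fin m) :=
  extChartAt (𝓡 m) x₁ ((extChartAt (𝓡 m) x₀).symm z)

theorem isOpen_chart_target (x₀ : M) : IsOpen (extChartAt (𝓡 m) x₀).target :=
  isOpen_extChartAt_target x₀

variable (m) in
/-- The set of coordinates, in the chart at `x₀`, of the points in the domain of the chart at
`x₁`. -/
def overlap (x₀ x₁ : M) : Set (EuclideanSpace ℝ (Fin m)) :=
  (extChartAt (𝓡 m) x₀).target ∩ (extChartAt (𝓡 m) x₀).symm ⁻¹' (extChartAt (𝓡 m) x₁).source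

theorem isOpen_overlap (x₀ x₁ : M) : IsOpen (overlap m x₀ x₁) :=
  (continuousOn_extChartAt_symm x₀).isOpen_inter_preimage (isOpen_chart_target x₀)
    (isOpen_extChartAt_source x₁)

theorem coordChange_mapsTo (x₀ x₁ : M) :
    MapsTo (coordChange x₀ x₁) (overlap m x₀ x₁) (overlap m x₁ x₀) := by
  intro z hz
  refine ⟨(extChartAt (𝓡 m) x₁).map_source hz.2, ?_⟩
  rw [mem_preimage, coordChange, (extChartAt (𝓡 m) x₁).left_inv hz.2]
  exact (extChartAt (𝓡 m) x₀).map_target hz.1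

theorem coordChange_coordChange {x₀ x₁ : M} {z : EuclideanSpace ℝ (Fin m)}
    (hz : z ∈ overlap m x₀ x₁) : coordChange x₁ x₀ (coordChange x₀ x₁ z) = z := by
  rw [coordChange, coordChange, (extChartAt (𝓡 m) x₁).left_inv hz.2,
    (extChartAt (𝓡 m) x₀).right_inv hz.1]

theorem coordChange_injOn (x₀ x₁ : M) : InjOn (coordChange x₀ x₁) (overlap m x₀ x₁) := by
  intro z hz w hw h
  rw [← coordChange_coordChange hz, h, coordChange_coordChange hw]

theorem coordChange_image (x₀ x₁ : M) :
    coordChange x₀ x₁ '' overlap m x₀ x₁ = overlap m x₁ x₀ := by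
  apply subset_antisymm
  · exact (coordChange_mapsTo x₀ x₁).image_subset
  · intro z hz
    exact ⟨coordChange x₁ x₀ z, coordChange_mapsTo x₁ x₀ hz, coordChange_coordChange hz⟩

theorem symm_coordChange {x₀ x₁ : M} {z : EuclideanSpace ℝ (Fin m)} (hz : z ∈ overlap m x₀ x₁) :
    (extChartAt (𝓡 m) x₁).symm (coordChange x₀ x₁ z) = (extChartAt (𝓡 m) x₀).symm z := by
  rw [coordChange, (extChartAt (𝓡 m) x₁).left_inv hz.2]

variable [IsManifold (𝓡 m) ∞ M]

theorem contDiffOn_coordChange (x₀ x₁ : M) :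
    ContDiffOn ℝ ∞ (coordChange x₀ x₁) (overlap m x₀ x₁) :=
  contDiffOn_ext_coord_change (I := 𝓡 m) x₁ x₀

theorem contDiffAt_coordChange {x₀ x₁ : M} {z : EuclideanSpace ℝ (Fin m)}
    (hz : z ∈ overlap m x₀ x₁) : ContDiffAt ℝ ∞ (coordChange x₀ x₁) z :=
  (contDiffOn_coordChange x₀ x₁).contDiffAt ((isOpen_overlap x₀ x₁).mem_nhds hz)

theorem mdifferentiableAt_chart_symm {x₀ : M} {z : EuclideanSpace ℝ (Fin m)}
    (hz : z ∈ (extChartAt (𝓡 m) x₀).target) :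
    MDifferentiableAt 𝓘(ℝ, EuclideanSpace ℝ (Fin m)) (𝓡 m) (extChartAt (𝓡 m) x₀).symm z := by
  have := mdifferentiableWithinAt_extChartAt_symm (I := 𝓡 m) hz
  rwa [ModelWithCorners.Boundaryless.range_eq_univ, mdifferentiableWithinAt_univ] at this

theorem chartDeriv_comp_symmDeriv {x₀ : M} {z : EuclideanSpace ℝ (Fin m)}
    (hz : z ∈ (extChartAt (𝓡 m) x₀).target) :
    (chartDeriv x₀ ((extChartAt (𝓡 m) x₀).symm z)).comp (symmDeriv x₀ z) =
      ContinuousLinearMap.id ℝ _ := by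
  have := mfderiv_extChartAt_comp_mfderivWithin_extChartAt_symm (I := 𝓡 m) hz
  rw [ModelWithCorners.Boundaryless.range_eq_univ, mfderivWithin_univ] at this
  exact this

theorem symmDeriv_comp_chartDeriv {x₀ : M} {z : EuclideanSpace ℝ (Fin m)}
    (hz : z ∈ (extChartAt (𝓡 m) x₀).target) :
    (symmDeriv x₀ z).comp (chartDeriv x₀ ((extChartAt (𝓡 m) x₀).symm z)) =
      ContinuousLinearMap.id ℝ _ := by
  have := mfderivWithin_extChartAt_symm_comp_mfderiv_extChartAt (I := 𝓡 m) hz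
  rw [ModelWithCorners.Boundaryless.range_eq_univ, mfderivWithin_univ] at this
  exact this

theorem fderiv_coordChange {x₀ x₁ : M} {z : EuclideanSpace ℝ (Fin m)}
    (hz : z ∈ overlap m x₀ x₁) :
    fderiv ℝ (coordChange x₀ x₁) z =
      (chartDeriv x₁ ((extChartAt (𝓡 m) x₀).symm z)).comp (symmDeriv x₀ z) := by
  have h2 : (extChartAt (𝓡 m) x₀).symm z ∈ (chartAt (EuclideanSpace ℝ (Fin m)) x₁).source := by
    rw [← extChartAt_source (I := 𝓡 m)]; exact hz.2
  have := mfderiv_comp z (mdifferentiableAt_extChartAt (I := 𝓡 m) h2)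
    (mdifferentiableAt_chart_symm hz.1)
  rw [mfderiv_eq_fderiv] at this
  exact this

theorem symmDeriv_coordChange {x₀ x₁ : M} {z : EuclideanSpace ℝ (Fin m)}
    (hz : z ∈ overlap m x₀ x₁) :
    (symmDeriv x₁ (coordChange x₀ x₁ z)).comp (fderiv ℝ (coordChange x₀ x₁) z) =
      symmDeriv x₀ z := by
  have h := symmDeriv_comp_chartDeriv (coordChange_mapsTo x₀ x₁ hz).1
  rw [symm_coordChange hz] at h
  rw [fderiv_coordChange hz, ← ContinuousLinearMap.comp_assoc, h, ContinuousLinearMap.id_comp]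

/-- The expressions of a form in two charts are related by pullback. -/
theorem inChart_eq_pullback {p : ℕ} (u : Form m M p) {x₀ x₁ : M} {z : EuclideanSpace ℝ (Fin m)}
    (hz : z ∈ overlap m x₀ x₁) :
    inChart x₀ u z = (inChart x₁ u (coordChange x₀ x₁ z)).compContinuousLinearMap
      (fderiv ℝ (coordChange x₀ x₁) z) := by
  rw [inChart_eq, inChart_eq, symm_coordChange hz, ← symmDeriv_coordChange hz]
  rfl

omit [IsManifold (𝓡 m) ∞ M] in
theorem IsSmoothForm.differentiableAt {p : ℕ} {u : Form m M p} (hu : IsSmoothForm u) {x₀ : M}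
    {z : EuclideanSpace ℝ (Fin m)} (hz : z ∈ (extChartAt (𝓡 m) x₀).target) :
    DifferentiableAt ℝ (inChart x₀ u) z :=
  ((hu x₀).contDiffAt ((isOpen_chart_target x₀).mem_nhds hz)).differentiableAt (by simp)

/-- The exterior derivative may be computed in any chart. -/
theorem inChart_extDer {p : ℕ} {u : Form m M p} (hu : IsSmoothForm u) {x₀ : M}
    {z : EuclideanSpace ℝ (Fin m)} (hz : z ∈ (extChartAt (𝓡 m) x₀).target) :
    inChart x₀ (extDer u) z = extDeriv (inChart x₀ u) z := by
  set y := (extChartAt (𝓡 m) x₀).symm z with hy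
  have hz' : z ∈ overlap m x₀ y := ⟨hz, mem_extChartAt_source y⟩
  have heq : inChart x₀ u =ᶠ[𝓝 z] fun z =>
      (inChart y u (coordChange x₀ y z)).compContinuousLinearMap
        (fderiv ℝ (coordChange x₀ y) z) := by
    filter_upwards [(isOpen_overlap x₀ y).mem_nhds hz'] with w hw using inChart_eq_pullback u hw
  have hsmooth : minSmoothness ℝ 2 ≤ ∞ := by
    rw [minSmoothness_of_isRCLikeNormedField]
    exact WithTop.coe_le_coe.2 le_top
  rw [heq.extDeriv_eq, extDeriv_pullback (hu.differentiableAt (coordChange_mapsTo _ _ hz').1)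
    (contDiffAt_coordChange hz') hsmooth, inChart_eq, ← hy, flatForm_extDer,
    fderiv_coordChange hz']
  rfl

theorem IsSmoothForm.extDer {p : ℕ} {u : Form m M p} (hu : IsSmoothForm u) :
    IsSmoothForm (extDer u) := by
  intro x₀
  refine ContDiffOn.congr (f := extDeriv (inChart x₀ u)) ?_ fun z hz => inChart_extDer hu hz
  have h1 : ContDiffOn ℝ ∞ (fderiv ℝ (inChart x₀ u)) (extChartAt (𝓡 m) x₀).target :=
    (hu x₀).fderiv_of_isOpen (isOpen_chart_target x₀) (by simp)
  exact (ContinuousAlternatingMap.alternatizeUncurryFinCLM ℝ (EuclideanSpace ℝ (Fin m))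
    ℝ).contDiff.comp_contDiffOn h1

omit [IsManifold (𝓡 m) ∞ M] in
theorem extDer_add {p : ℕ} {u v : Form m M p} (hu : IsSmoothForm u) (hv : IsSmoothForm v) :
    extDer (u + v) = extDer u + extDer v := by
  funext x
  change flatForm (extDer (u + v)) x = flatForm (extDer u) x + flatForm (extDer v) x
  have hx := mem_extChartAt_target (I := 𝓡 m) x
  rw [flatForm_extDer, inChart_add, extDeriv_add (hu.differentiableAt hx) (hv.differentiableAt hx)]
  rfl

omit [IsManifold (𝓡 m) ∞ M] in
theorem extDer_smul {p : ℕ} (c : ℝ) (u : Form m M p) : extDer (c • u) = c • extDer u := by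
  funext x
  change flatForm (extDer (c • u)) x = c • flatForm (extDer u) x
  rw [flatForm_extDer, inChart_smul, extDeriv_smul]
  rfl

end Charts

/-! ### Smoothness of the star operator -/

section Orientation

variable {V : Type*} [NormedAddCommGroup V] [InnerProductSpace ℝ V] [FiniteDimensional ℝ V]
variable {m : ℕ} [Fact (Module.finrank ℝ V = m)]

/-- The sign of a frame is defined by an arbitrary representative of the orientation, which is a
positive multiple of the volume form. -/
theorem frameSign_eq_sign_volumeForm (o : Orientation ℝ V (Fin m)) (w : Fin m → V) :
    frameSign o w = SignType.sign (o.volumeForm w) := by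
  obtain rfl : Module.finrank ℝ V = m := Fact.out
  set e := stdOrthonormalBasis ℝ V with he
  have hray : SameRay ℝ o.someVector o.volumeForm ∧ o.volumeForm ≠ 0 := by
    have hdet : e.toBasis.det ≠ 0 := e.toBasis.det_ne_zero
    by_cases ho : e.toBasis.orientation = o
    · rw [o.volumeForm_robust e ho]
      refine ⟨?_, hdet⟩
      rw [← ray_eq_iff o.someVector_ne_zero hdet, Module.Ray.someVector_ray, ← ho]
      rfl
    · rw [o.volumeForm_robust_neg e ho]
      refine ⟨?_, neg_ne_zero.2 hdet⟩
      rw [← ray_eq_iff o.someVector_ne_zero (neg_ne_zero.2 hdet), Module.Ray.someVector_ray,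
        (e.toBasis.orientation_ne_iff_eq_neg o).1 (Ne.symm ho), Module.Basis.orientation,
        neg_rayOfNeZero]
  obtain ⟨r, hr, hrw⟩ := hray.1.exists_pos_left o.someVector_ne_zero hray.2
  rw [frameSign, ← hrw, AlternatingMap.smul_apply, smul_eq_mul, sign_mul, sign_pos hr, one_mul]

theorem volumeForm_basis_ne_zero (o : Orientation ℝ V (Fin m)) (b : Module.Basis (Fin m) ℝ V) :
    o.volumeForm b ≠ 0 := by
  intro h0
  obtain rfl : Module.finrank ℝ V = m := Fact.out
  have h1 := o.volumeForm.eq_smul_basis_det b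
  rw [h0, zero_smul] at h1
  have h2 := o.abs_volumeForm_apply_of_orthonormal (stdOrthonormalBasis ℝ V)
  rw [h1] at h2
  simp at h2

theorem volumeForm_eq_frameSign_mul_sqrt (o : Orientation ℝ V (Fin m)) (w : Fin m → V) :
    o.volumeForm w = frameSign o w * √(gramMatrix w).det := by
  rw [frameSign_eq_sign_volumeForm, det_gramMatrix o, Real.sqrt_sq_eq_abs, sign_mul_abs]

end Orientation

section Matrix

theorem contDiffOn_matrix_det {n : ℕ} {F : Type*} [NormedAddCommGroup F] [NormedSpace ℝ F]
    {s : Set F} {A : F → Matrix (Fin n) (Fin n) ℝ}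
    (hA : ∀ i j, ContDiffOn ℝ ∞ (fun z => A z i j) s) :
    ContDiffOn ℝ ∞ (fun z => (A z).det) s := by
  simp only [Matrix.det_apply]
  refine ContDiffOn.sum fun σ _ => ContDiffOn.const_smul _ ?_
  exact contDiffOn_prod fun i _ => hA _ _

theorem contDiffOn_matrix_inv {n : ℕ} {F : Type*} [NormedAddCommGroup F] [NormedSpace ℝ F]
    {s : Set F} {A : F → Matrix (Fin n) (Fin n) ℝ}
    (hA : ∀ i j, ContDiffOn ℝ ∞ (fun z => A z i j) s)
    (h0 : ∀ z ∈ s, (A z).det ≠ 0) (i j : Fin n) :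
    ContDiffOn ℝ ∞ (fun z => (A z)⁻¹ i j) s := by
  simp only [Matrix.inv_def, Matrix.smul_apply, Ring.inverse_eq_inv', Matrix.adjugate_apply,
    smul_eq_mul]
  refine ((contDiffOn_matrix_det hA).inv h0).mul (contDiffOn_matrix_det fun k l => ?_)
  simp only [Matrix.updateRow_apply]
  split_ifs
  · exact contDiffOn_const
  · exact hA k l

end Matrix

section Manifold

variable {m : ℕ} {M : Type*} [TopologicalSpace M] [ChartedSpace (EuclideanSpace ℝ (Fin m)) M]

variable [IsManifold (𝓡 m) ∞ M]

/-- The derivative of the inverse of a chart, as a linear equivalence. -/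
def symmDerivEquiv {x₀ : M} {z : EuclideanSpace ℝ (Fin m)}
    (hz : z ∈ (extChartAt (𝓡 m) x₀).target) :
    EuclideanSpace ℝ (Fin m) ≃ₗ[ℝ] TangentSpace (𝓡 m) ((extChartAt (𝓡 m) x₀).symm z) :=
  LinearEquiv.ofLinearMap (symmDeriv x₀ z).toLinearMap
    (chartDeriv x₀ ((extChartAt (𝓡 m) x₀).symm z)).toLinearMap
    (by
      have := symmDeriv_comp_chartDeriv hz
      exact congrArg ContinuousLinearMap.toLinearMap this)
    (by
      have := chartDeriv_comp_symmDeriv hz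
      exact congrArg ContinuousLinearMap.toLinearMap this)

/-- The coordinate frame of a chart, as a basis of the tangent space. -/
def coordBasis {x₀ : M} {z : EuclideanSpace ℝ (Fin m)}
    (hz : z ∈ (extChartAt (𝓡 m) x₀).target) :
    Module.Basis (Fin m) ℝ (TangentSpace (𝓡 m) ((extChartAt (𝓡 m) x₀).symm z)) :=
  (EuclideanSpace.basisFun (Fin m) ℝ).toBasis.map (symmDerivEquiv hz)

theorem coe_coordBasis {x₀ : M} {z : EuclideanSpace ℝ (Fin m)}
    (hz : z ∈ (extChartAt (𝓡 m) x₀).target) : ⇑(coordBasis hz) = coordFrame x₀ z := by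
  funext i
  change symmDeriv x₀ z ((EuclideanSpace.basisFun (Fin m) ℝ).toBasis i) = _
  rw [OrthonormalBasis.coe_toBasis, EuclideanSpace.basisFun_apply]
  rfl

omit [IsManifold (𝓡 m) ∞ M] in
/-- The sign of a chart is locally constant. -/
theorem chartSign_eventuallyEq (o : ManifoldOrientation m M) {x₀ : M}
    {z : EuclideanSpace ℝ (Fin m)} (hz : z ∈ (extChartAt (𝓡 m) x₀).target) :
    chartSign o.orient x₀ =ᶠ[𝓝 z] fun _ => chartSign o.orient x₀ z := by
  have hc := (o.continuousOn x₀).continuousAt ((isOpen_chart_target x₀).mem_nhds hz)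
  have := Metric.tendsto_nhds.1 hc 1 one_pos
  filter_upwards [this] with w hw
  rw [Real.dist_eq] at hw
  unfold chartSign frameSign at hw ⊢
  -- distinct values of the sign have distance at least one
  generalize SignType.sign
    ((o.orient ((extChartAt (𝓡 m) x₀).symm w)).someVector (coordFrame x₀ w)) = a at *
  generalize SignType.sign
    ((o.orient ((extChartAt (𝓡 m) x₀).symm z)).someVector (coordFrame x₀ z)) = b at *
  rcases a with _ | _ | _ <;> rcases b with _ | _ | _ <;> first | rfl | (exfalso; norm_num at hw)

omit [IsManifold (𝓡 m) ∞ M] in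
theorem contDiffOn_chartSign (o : ManifoldOrientation m M) (x₀ : M) :
    ContDiffOn ℝ ∞ (chartSign o.orient x₀) (extChartAt (𝓡 m) x₀).target := fun _ hz =>
  ((contDiffAt_const).congr_of_eventuallyEq (chartSign_eventuallyEq o hz)).contDiffWithinAt

variable [RiemannianBundle (fun x : M => TangentSpace (𝓡 m) x)]

omit [RiemannianBundle (fun x : M => TangentSpace (𝓡 m) x)] in
theorem contMDiffOn_coordFrame (x₀ : M) (i : Fin m) :
    ContMDiffOn 𝓘(ℝ, EuclideanSpace ℝ (Fin m)) (𝓡 m).tangent ∞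
      (fun z => (⟨(extChartAt (𝓡 m) x₀).symm z, coordFrame x₀ z i⟩ : TangentBundle (𝓡 m) M))
      (extChartAt (𝓡 m) x₀).target := by
  have ho := isOpen_chart_target (m := m) x₀
  have h1 := (contMDiffOn_extChartAt_symm (I := 𝓡 m) (n := ∞) x₀).contMDiffOn_tangentMapWithin
    (m := ∞) (by simp) ho.uniqueMDiffOn
  have h2 : ContMDiff 𝓘(ℝ, EuclideanSpace ℝ (Fin m)) 𝓘(ℝ, EuclideanSpace ℝ (Fin m)).tangent ∞
      (fun z => (⟨z, EuclideanSpace.single i (1 : ℝ)⟩ :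
        TangentBundle 𝓘(ℝ, EuclideanSpace ℝ (Fin m)) (EuclideanSpace ℝ (Fin m)))) :=
    contMDiff_vectorSpace_iff_contDiff.2 contDiff_const
  have h3 := h1.comp h2.contMDiffOn (s := (extChartAt (𝓡 m) x₀).target) (fun z hz => hz)
  refine h3.congr fun z hz => ?_
  simp only [Function.comp, tangentMapWithin]
  rw [mfderivWithin_of_isOpen ho hz]
  rfl

variable [IsContMDiffRiemannianBundle (𝓡 m) ∞ (EuclideanSpace ℝ (Fin m))
      (fun x : M => TangentSpace (𝓡 m) x)]

theorem contDiffOn_gramMatrix (x₀ : M) (i j : Fin m) :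
    ContDiffOn ℝ ∞ (fun z => gramMatrix (coordFrame x₀ z) i j) (extChartAt (𝓡 m) x₀).target := by
  rw [← contMDiffOn_iff_contDiffOn]
  exact (contMDiffOn_coordFrame x₀ i).inner_bundle (contMDiffOn_coordFrame x₀ j)

omit [IsContMDiffRiemannianBundle (𝓡 m) ∞ (EuclideanSpace ℝ (Fin m))
      (fun x : M => TangentSpace (𝓡 m) x)] in
theorem det_gramMatrix_coordFrame_pos (o : ManifoldOrientation m M) {x₀ : M}
    {z : EuclideanSpace ℝ (Fin m)} (hz : z ∈ (extChartAt (𝓡 m) x₀).target) :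
    0 < (gramMatrix (coordFrame x₀ z)).det := by
  rw [det_gramMatrix (o.orient ((extChartAt (𝓡 m) x₀).symm z)), ← coe_coordBasis hz]
  exact sq_pos_of_ne_zero (volumeForm_basis_ne_zero _ _)

omit [IsContMDiffRiemannianBundle (𝓡 m) ∞ (EuclideanSpace ℝ (Fin m))
      (fun x : M => TangentSpace (𝓡 m) x)] in
/-- The expression of `⋆ v` in a chart. The forms on the right do not depend on `z`, and their
coefficients are smooth if `v` is. -/
theorem inChart_starForm (o : ManifoldOrientation m M) {p q : ℕ} (h : p + q = m)
    [Fact (Module.finrank ℝ (EuclideanSpace ℝ (Fin m)) = m)]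
    (v : Form m M p) {x₀ : M} {z : EuclideanSpace ℝ (Fin m)}
    (hz : z ∈ (extChartAt (𝓡 m) x₀).target) :
    inChart x₀ (starForm o h v) z = ∑ g : Fin p → Fin m, ∑ g' : Fin p → Fin m,
      ((p.factorial : ℝ)⁻¹ * (∏ k, (gramMatrix (coordFrame x₀ z))⁻¹ (g k) (g' k)) *
        inChart x₀ v z (fun k => EuclideanSpace.single (g k) (1 : ℝ)) *
        (chartSign o.orient x₀ z * √(gramMatrix (coordFrame x₀ z)).det)) •
      volContract (EuclideanSpace.basisFun (Fin m) ℝ).toBasis.orientation h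
        (fun k => EuclideanSpace.single (g' k) (1 : ℝ)) := by
  ext w
  set y := (extChartAt (𝓡 m) x₀).symm z with hy
  have h1 : inChart x₀ (starForm o h v) z w = hodgeStar (o.orient y) h (v y)
      (fun i => symmDeriv x₀ z (w i)) := rfl
  have hvol : ∀ w : Fin m → EuclideanSpace ℝ (Fin m),
      (o.orient y).volumeForm (fun i => symmDeriv x₀ z (w i)) =
        chartSign o.orient x₀ z * √(gramMatrix (coordFrame x₀ z)).det *
          (EuclideanSpace.basisFun (Fin m) ℝ).toBasis.det w := by
    intro w
    have h2 := congrArg (fun f => f w) (((o.orient y).volumeForm.compLinearMap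
      (symmDerivEquiv hz).toLinearMap).eq_smul_basis_det
        (EuclideanSpace.basisFun (Fin m) ℝ).toBasis)
    have h3 := volumeForm_eq_frameSign_mul_sqrt (o.orient y) (coordFrame x₀ z)
    have h4 : (o.orient y).volumeForm.compLinearMap (symmDerivEquiv hz).toLinearMap
        (EuclideanSpace.basisFun (Fin m) ℝ).toBasis =
          (o.orient y).volumeForm (coordFrame x₀ z) := by
      rw [← coe_coordBasis hz]; rfl
    rw [h4, h3] at h2
    exact h2
  refine (h1.trans (hodgeStar_apply_basis (o.orient y) h (coordBasis hz) (v y)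
    (fun i => symmDeriv x₀ z (w i)))).trans ?_
  rw [coe_coordBasis, ContinuousAlternatingMap.sum_apply, Finset.mul_sum]
  refine Finset.sum_congr rfl fun g _ => ?_
  rw [ContinuousAlternatingMap.sum_apply, Finset.mul_sum]
  refine Finset.sum_congr rfl fun g' _ => ?_
  have h5 : Sum.elim (coordFrame x₀ z ∘ g') (fun i => symmDeriv x₀ z (w i)) ∘ (sumEquiv h).symm =
      fun i => symmDeriv x₀ z ((Sum.elim (fun k => EuclideanSpace.single (g' k) (1 : ℝ)) w ∘
        (sumEquiv h).symm) i) := by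
    funext i
    obtain ⟨j, rfl⟩ := (sumEquiv h).surjective i
    rcases j with j | j
    · simp only [Function.comp, Equiv.symm_apply_apply, Sum.elim_inl]
      rfl
    · simp only [Function.comp, Equiv.symm_apply_apply, Sum.elim_inr]
      rfl
  have h6 : volContract (o.orient y) h (coordFrame x₀ z ∘ g') (fun i => symmDeriv x₀ z (w i)) =
      chartSign o.orient x₀ z * √(gramMatrix (coordFrame x₀ z)).det *
        volContract (EuclideanSpace.basisFun (Fin m) ℝ).toBasis.orientation h
          (fun k => EuclideanSpace.single (g' k) (1 : ℝ)) w := by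
    have h7 := hvol (Sum.elim (fun k => EuclideanSpace.single (g' k) (1 : ℝ)) w ∘ (sumEquiv h).symm)
    rw [← h5] at h7
    rw [volContract_apply (EuclideanSpace.basisFun (Fin m) ℝ).toBasis.orientation,
      Orientation.volumeForm_robust _ (EuclideanSpace.basisFun (Fin m) ℝ) rfl]
    exact h7
  have h8 : v y (coordFrame x₀ z ∘ g) =
    inChart x₀ v z (fun k => EuclideanSpace.single (g k) (1 : ℝ)) := rfl
  rw [ContinuousAlternatingMap.smul_apply, smul_eq_mul, h6, h8]
  ring

theorem IsSmoothForm.starForm (o : ManifoldOrientation m M) {p q : ℕ} (h : p + q = m)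
    {v : Form m M p} (hv : IsSmoothForm v) : IsSmoothForm (starForm o h v) := by
  have : Fact (Module.finrank ℝ (EuclideanSpace ℝ (Fin m)) = m) := ⟨finrank_euclideanSpace_fin⟩
  intro x₀
  refine ContDiffOn.congr ?_ fun z hz => inChart_starForm o h v hz
  have hG := contDiffOn_gramMatrix (m := m) x₀
  have hpos := fun z hz => det_gramMatrix_coordFrame_pos o (x₀ := x₀) (z := z) hz
  refine ContDiffOn.sum fun g _ => ContDiffOn.sum fun g' _ =>
    ContDiffOn.fun_smul ?_ contDiffOn_const
  refine ((contDiffOn_const.mul ?_).mul ?_).mul ((contDiffOn_chartSign o x₀).mul ?_)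
  · exact contDiffOn_prod fun k _ => contDiffOn_matrix_inv hG (fun z hz => (hpos z hz).ne') _ _
  · exact (ContinuousAlternatingMap.apply ℝ (EuclideanSpace ℝ (Fin m)) ℝ
      _).contDiff.comp_contDiffOn (hv x₀)
  · exact (contDiffOn_matrix_det hG).sqrt fun z hz => (hpos z hz).ne'

end Manifold

/-! ### Stokes' theorem in Euclidean space -/

section Euclidean

variable {m k q : ℕ}

theorem eq_sum_proj_smulRight {F : Type*} [NormedAddCommGroup F] [NormedSpace ℝ F]
    (A : EuclideanSpace ℝ (Fin m) →L[ℝ] F) :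
    A = ∑ i, (EuclideanSpace.proj i : EuclideanSpace ℝ (Fin m) →L[ℝ] ℝ).smulRight
      (A (EuclideanSpace.single i 1)) := by
  ext x
  have hx := (EuclideanSpace.basisFun (Fin m) ℝ).sum_repr x
  conv_lhs => rw [← hx]
  simp [map_sum, _root_.sum_apply]

/-- In coordinates `dθ = ∑ dx_i ∧ ∂_i θ`. -/
theorem extDeriv_eq_sum_covWedge
    (θ : EuclideanSpace ℝ (Fin m) → (EuclideanSpace ℝ (Fin m)) [⋀^Fin k]→L[ℝ] ℝ)
    (z : EuclideanSpace ℝ (Fin m)) :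
    extDeriv θ z = ∑ i, covWedge (EuclideanSpace.proj i)
      (fderiv ℝ θ z (EuclideanSpace.single i 1)) := by
  rw [extDeriv, eq_sum_proj_smulRight (fderiv ℝ θ z),
    ← ContinuousAlternatingMap.alternatizeUncurryFinCLM_apply, map_sum]
  simp only [← eq_sum_proj_smulRight]
  rfl

/-- The bilinear map `(a, b) ↦ (ℓ ∧ a ∧ b) (v)`. -/
def covWedgePairing (h : k + 1 + q = m) (l : EuclideanSpace ℝ (Fin m) →L[ℝ] ℝ)
    (v : Fin m → EuclideanSpace ℝ (Fin m)) :
    ((EuclideanSpace ℝ (Fin m)) [⋀^Fin k]→L[ℝ] ℝ) →L[ℝ]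
      ((EuclideanSpace ℝ (Fin m)) [⋀^Fin q]→L[ℝ] ℝ) →L[ℝ] ℝ :=
  (wedgePairing (EuclideanSpace ℝ (Fin m)) h v).comp
    ((ContinuousAlternatingMap.alternatizeUncurryFinCLM ℝ (EuclideanSpace ℝ (Fin m)) ℝ).comp
      (ContinuousLinearMap.smulRightL ℝ (EuclideanSpace ℝ (Fin m)) _ l))

theorem covWedgePairing_apply (h : k + 1 + q = m) (l : EuclideanSpace ℝ (Fin m) →L[ℝ] ℝ)
    (v : Fin m → EuclideanSpace ℝ (Fin m)) (a : (EuclideanSpace ℝ (Fin m)) [⋀^Fin k]→L[ℝ] ℝ)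
    (b : (EuclideanSpace ℝ (Fin m)) [⋀^Fin q]→L[ℝ] ℝ) :
    covWedgePairing h l v a b = wedgePairing _ h v (covWedge l a) b := rfl

theorem integrableOn_of_continuousOn_of_eq_zero {F : Type*} [NormedAddCommGroup F]
    {T K : Set (EuclideanSpace ℝ (Fin m))} (hT : IsOpen T) (hK : IsCompact K) (hKT : K ⊆ T)
    {f : EuclideanSpace ℝ (Fin m) → F} (hf : ContinuousOn f T) (h0 : ∀ z ∈ T \ K, f z = 0) :
    IntegrableOn f T :=
  ((hf.mono hKT).integrableOn_compact hK).of_forall_sdiff_eq_zero hT.measurableSet h0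

/-- A directional derivative of a function with compact support in an open set is integrable and
its integral vanishes: extend the function by zero and integrate by parts against `1`. -/
theorem setIntegral_lineDeriv_eq_zero
    {T K : Set (EuclideanSpace ℝ (Fin m))} (hT : IsOpen T) (hK : IsCompact K) (hKT : K ⊆ T)
    {f : EuclideanSpace ℝ (Fin m) → ℝ}
    {f' : EuclideanSpace ℝ (Fin m) → EuclideanSpace ℝ (Fin m) →L[ℝ] ℝ}
    (e : EuclideanSpace ℝ (Fin m))
    (hf : ∀ z ∈ T, HasFDerivAt f (f' z) z) (hf' : ContinuousOn (fun z => f' z e) T)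
    (h0 : ∀ z ∈ T \ K, f z = 0) (h0' : ∀ z ∈ T \ K, f' z = 0) :
    ∫ z in T, f' z e = 0 ∧ IntegrableOn (fun z => f' z e) T := by
  have hint' : IntegrableOn (fun z => f' z e) T :=
    integrableOn_of_continuousOn_of_eq_zero hT hK hKT hf' fun z hz => by simp [h0' z hz]
  refine ⟨?_, hint'⟩
  have hint : IntegrableOn f T := integrableOn_of_continuousOn_of_eq_zero hT hK hKT
    (fun z hz => (hf z hz).continuousAt.continuousWithinAt) h0
  have hd : ∀ z, HasLineDerivAt ℝ (T.indicator f) (T.indicator (fun z => f' z e) z) z e := by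
    intro z
    by_cases hz : z ∈ T
    · rw [indicator_of_mem hz]
      refine ((hf z hz).congr_of_eventuallyEq ?_).hasLineDerivAt e
      filter_upwards [hT.mem_nhds hz] with y hy using indicator_of_mem hy f
    · rw [indicator_of_notMem hz]
      have hz' : z ∈ Kᶜ := fun h => hz (hKT h)
      have : T.indicator f =ᶠ[𝓝 z] fun _ => 0 := by
        filter_upwards [hK.isClosed.isOpen_compl.mem_nhds hz'] with y hy
        by_cases hyT : y ∈ T
        · rw [indicator_of_mem hyT, h0 y ⟨hyT, hy⟩]
        · exact indicator_of_notMem hyT f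
      have h1 := ((hasFDerivAt_const (0 : ℝ) z).congr_of_eventuallyEq this).hasLineDerivAt
        (𝕜 := ℝ) e
      simpa using h1
  have key := integral_bilinear_hasLineDerivAt_right_eq_neg_left_of_integrable (μ := volume)
    (f := fun _ => (1 : ℝ)) (f' := fun _ => 0) (g := T.indicator f)
    (g' := T.indicator (fun z => f' z e)) (v := e) (B := ContinuousLinearMap.mul ℝ ℝ)
    (by simp) (by simpa using hint'.integrable_indicator hT.measurableSet)
    (by simpa using hint.integrable_indicator hT.measurableSet)
    (fun x _ => (hasFDerivAt_const (1 : ℝ) x).hasLineDerivAt e |>.congr_deriv (by simp))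
    (fun x _ => hd x)
  simpa [integral_indicator hT.measurableSet] using key

/-- **Stokes' theorem** for `η ∧ θ` on an open subset of `ℝ^m`, `η` of compact support, against
a locally constant function `s`: the integral of `d(η ∧ θ)` vanishes. -/
theorem setIntegral_stokes
    (h₁ : k + 1 + q = m) (h₂ : k + (q + 1) = m) (e : Fin m → EuclideanSpace ℝ (Fin m))
    {T K : Set (EuclideanSpace ℝ (Fin m))} (hT : IsOpen T) (hK : IsCompact K) (hKT : K ⊆ T)
    {s : EuclideanSpace ℝ (Fin m) → ℝ} (hs : ∀ z ∈ T, s =ᶠ[𝓝 z] fun _ => s z)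
    {η : EuclideanSpace ℝ (Fin m) → (EuclideanSpace ℝ (Fin m)) [⋀^Fin k]→L[ℝ] ℝ}
    {θ : EuclideanSpace ℝ (Fin m) → (EuclideanSpace ℝ (Fin m)) [⋀^Fin q]→L[ℝ] ℝ}
    (hη : ContDiffOn ℝ ∞ η T) (hθ : ContDiffOn ℝ ∞ θ T) (h0 : ∀ z ∈ T \ K, η z = 0) :
    ∫ z in T, s z * (wedgePairing _ h₁ e (extDeriv η z) (θ z) +
      (-1) ^ k * wedgePairing _ h₂ e (η z) (extDeriv θ z)) = 0 := by
  have hηd : ∀ z ∈ T, HasFDerivAt η (fderiv ℝ η z) z := fun z hz =>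
    ((hη.contDiffAt (hT.mem_nhds hz)).differentiableAt (by simp)).hasFDerivAt
  have hθd : ∀ z ∈ T, HasFDerivAt θ (fderiv ℝ θ z) z := fun z hz =>
    ((hθ.contDiffAt (hT.mem_nhds hz)).differentiableAt (by simp)).hasFDerivAt
  have hη' : ContinuousOn (fderiv ℝ η) T := hη.continuousOn_fderiv_of_isOpen hT (by simp)
  have hθ' : ContinuousOn (fderiv ℝ θ) T := hθ.continuousOn_fderiv_of_isOpen hT (by simp)
  have hsc : ContinuousOn s T := fun z hz =>
    (continuousAt_const.congr (hs z hz).symm).continuousWithinAt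
  have h0d : ∀ z ∈ T \ K, fderiv ℝ η z = 0 := by
    intro z hz
    have : η =ᶠ[𝓝 z] fun _ => 0 := by
      filter_upwards [(hT.sdiff hK.isClosed).mem_nhds hz] with y hy using h0 y hy
    rw [this.fderiv_eq]; simp
  -- the `i`-th summand of the integrand is `∂_i` of `Q i (η z) (θ z) = (dx_i ∧ η ∧ θ) (e)`
  let Q : Fin m → _ := fun i => covWedgePairing h₁ (EuclideanSpace.proj i) e
  have main : ∀ i : Fin m, ∫ z in T, s z *
      (Q i (η z) (fderiv ℝ θ z (EuclideanSpace.single i 1)) +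
        Q i (fderiv ℝ η z (EuclideanSpace.single i 1)) (θ z)) = 0 ∧ IntegrableOn (fun z => s z *
      (Q i (η z) (fderiv ℝ θ z (EuclideanSpace.single i 1)) +
        Q i (fderiv ℝ η z (EuclideanSpace.single i 1)) (θ z))) T := by
    intro i
    refine setIntegral_lineDeriv_eq_zero hT hK hKT (f := fun z => s z * Q i (η z) (θ z))
      (f' := fun z => s z • ((Q i).precompR _ (η z) (fderiv ℝ θ z) +
        (Q i).precompL _ (fderiv ℝ η z) (θ z))) (EuclideanSpace.single i 1) ?_ ?_ ?_ ?_
    · intro z hz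
      have h1 := ((Q i).hasFDerivAt_of_bilinear (hηd z hz) (hθd z hz)).const_mul (s z)
      refine h1.congr_of_eventuallyEq ?_
      filter_upwards [hs z hz] with y hy
      rw [hy]
    · refine hsc.mul (ContinuousOn.add ?_ ?_)
      · exact ((Q i).continuous.comp_continuousOn hη.continuousOn).clm_apply
          (hθ'.clm_apply continuousOn_const)
      · exact ((Q i).continuous.comp_continuousOn (hη'.clm_apply continuousOn_const)).clm_apply
          hθ.continuousOn
    · intro z hz
      simp [h0 z hz]
    · intro z hz
      ext x
      change s z * (Q i (η z) (fderiv ℝ θ z x) + Q i (fderiv ℝ η z x) (θ z)) = 0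
      rw [h0 z hz, h0d z hz, map_zero, _root_.zero_apply, _root_.zero_apply, map_zero,
        _root_.zero_apply, add_zero, mul_zero]
  have hsum := integral_finsetSum (μ := volume.restrict T) Finset.univ fun i _ => (main i).2
  rw [Finset.sum_eq_zero fun i _ => (main i).1] at hsum
  rw [← hsum]
  refine setIntegral_congr_fun hT.measurableSet fun z _ => ?_
  rw [← Finset.mul_sum, Finset.sum_add_distrib, add_comm]
  congr 2
  · simp only [extDeriv_eq_sum_covWedge, map_sum, Finset.mul_sum]
    refine Finset.sum_congr rfl fun i _ => ?_
    simp only [Q, covWedgePairing_apply, wedgePairing_apply]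
    rw [wedge_covWedge_left h₁ h₂]
  · simp only [extDeriv_eq_sum_covWedge, map_sum, _root_.sum_apply]
    rfl

end Euclidean

/-! ### Integration of forms supported in charts -/

section Integration

variable {m : ℕ} {M : Type*} [TopologicalSpace M] [ChartedSpace (EuclideanSpace ℝ (Fin m)) M]

/-- The coefficient of an `m`-form at `dx₁ ∧ ⋯ ∧ dx_m` in the chart at `x₀`. -/
def topCoeff (x₀ : M) (σ : Form m M m) (z : EuclideanSpace ℝ (Fin m)) : ℝ :=
  inChart x₀ σ z (fun i => EuclideanSpace.single i (1 : ℝ))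

/-- An `m`-form with continuous coefficients. -/
def IsContinuousTopForm (σ : Form m M m) : Prop :=
  ∀ x₀ : M, ContinuousOn (topCoeff x₀ σ) (extChartAt (𝓡 m) x₀).target

theorem chartIntegral_eq (o : ManifoldOrientation m M) (x₀ : M) (σ : Form m M m) :
    chartIntegral o x₀ σ =
      ∫ z in (extChartAt (𝓡 m) x₀).target, chartSign o.orient x₀ z * topCoeff x₀ σ z := rfl

theorem topCoeff_add (x₀ : M) (σ τ : Form m M m) :
    topCoeff x₀ (σ + τ) = topCoeff x₀ σ + topCoeff x₀ τ := rfl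

theorem topCoeff_fun_smul (x₀ : M) (f : M → ℝ) (σ : Form m M m) (z : EuclideanSpace ℝ (Fin m)) :
    topCoeff x₀ (fun x => f x • σ x) z = f ((extChartAt (𝓡 m) x₀).symm z) * topCoeff x₀ σ z := rfl

theorem inChart_eq_zero {p : ℕ} {u : Form m M p} {x₀ : M} {z : EuclideanSpace ℝ (Fin m)}
    (h : u ((extChartAt (𝓡 m) x₀).symm z) = 0) : inChart x₀ u z = 0 := by
  have h' : flatForm u ((extChartAt (𝓡 m) x₀).symm z) = 0 := h
  rw [inChart_eq, h']
  rfl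

theorem topCoeff_eq_zero {σ : Form m M m} {x₀ : M} {z : EuclideanSpace ℝ (Fin m)}
    (h : σ ((extChartAt (𝓡 m) x₀).symm z) = 0) : topCoeff x₀ σ z = 0 := by
  rw [topCoeff, inChart_eq_zero h]
  rfl

theorem IsContinuousTopForm.smul {f : M → ℝ} (hf : Continuous f) {σ : Form m M m}
    (hσ : IsContinuousTopForm σ) : IsContinuousTopForm (fun x => f x • σ x) :=
  fun x₀ => (hf.comp_continuousOn (continuousOn_extChartAt_symm x₀)).mul (hσ x₀)

/-- The coordinates of a compact subset of the domain of a chart. -/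
theorem isCompact_image_chart {K : Set M} (hK : IsCompact K) {x₀ : M}
    (hKs : K ⊆ (extChartAt (𝓡 m) x₀).source) :
    IsCompact (extChartAt (𝓡 m) x₀ '' K) ∧
      extChartAt (𝓡 m) x₀ '' K ⊆ (extChartAt (𝓡 m) x₀).target ∧
      ∀ z ∈ (extChartAt (𝓡 m) x₀).target \ (extChartAt (𝓡 m) x₀ '' K),
        (extChartAt (𝓡 m) x₀).symm z ∉ K := by
  refine ⟨hK.image_of_continuousOn ((continuousOn_extChartAt x₀).mono hKs), ?_, ?_⟩
  · rintro _ ⟨x, hx, rfl⟩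
    exact (extChartAt (𝓡 m) x₀).map_source (hKs hx)
  · rintro z ⟨hz, hzK⟩ hmem
    exact hzK ⟨_, hmem, (extChartAt (𝓡 m) x₀).right_inv hz⟩

theorem integrableOn_topCoeff (o : ManifoldOrientation m M) {σ : Form m M m}
    (hσ : IsContinuousTopForm σ) {K : Set M} (hK : IsCompact K) {x₀ : M}
    (hKs : K ⊆ (extChartAt (𝓡 m) x₀).source) (h0 : ∀ x ∉ K, σ x = 0) :
    IntegrableOn (fun z => chartSign o.orient x₀ z * topCoeff x₀ σ z)
      (extChartAt (𝓡 m) x₀).target := by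
  obtain ⟨h1, h2, h3⟩ := isCompact_image_chart hK hKs
  refine integrableOn_of_continuousOn_of_eq_zero (isOpen_chart_target x₀) h1 h2
    ((o.continuousOn x₀).mul (hσ x₀)) fun z hz => ?_
  rw [topCoeff_eq_zero (h0 _ (h3 z hz)), mul_zero]

/-- Alternating `m`-forms on `ℝ^m` scale by the determinant. -/
theorem alternating_comp_eq_det {W : Type*} [AddCommGroup W] [Module ℝ W]
    (b : Module.Basis (Fin m) ℝ W) (f : W [⋀^Fin m]→ₗ[ℝ] ℝ) (A : W →ₗ[ℝ] W) :
    f (fun i => A (b i)) = LinearMap.det A * f b := by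
  have h1 := f.eq_smul_basis_det b
  have h2 := b.det_comp A b
  have h3 : f (A ∘ b) = f b * b.det (A ∘ b) := by
    conv_lhs => rw [h1]
    rfl
  rw [h2, b.det_self, mul_one] at h3
  rw [mul_comm]
  exact h3

variable [IsManifold (𝓡 m) ∞ M]

theorem topCoeff_coordChange (σ : Form m M m) {x₀ x₁ : M} {z : EuclideanSpace ℝ (Fin m)}
    (hz : z ∈ overlap m x₀ x₁) :
    topCoeff x₀ σ z = (fderiv ℝ (coordChange x₀ x₁) z).det *
      topCoeff x₁ σ (coordChange x₀ x₁ z) := by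
  rw [topCoeff, inChart_eq_pullback σ hz, topCoeff]
  have := alternating_comp_eq_det (EuclideanSpace.basisFun (Fin m) ℝ).toBasis
    (inChart x₁ σ (coordChange x₀ x₁ z)).toAlternatingMap
    (fderiv ℝ (coordChange x₀ x₁) z).toLinearMap
  have hb : ⇑(EuclideanSpace.basisFun (Fin m) ℝ).toBasis =
      fun i => EuclideanSpace.single i (1 : ℝ) := by
    funext i; simp
  rw [hb] at this
  exact this

theorem chartSign_coordChange (o : ManifoldOrientation m M) {x₀ x₁ : M}
    {z : EuclideanSpace ℝ (Fin m)} (hz : z ∈ overlap m x₀ x₁) :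
    chartSign o.orient x₀ z = SignType.sign (fderiv ℝ (coordChange x₀ x₁) z).det *
      chartSign o.orient x₁ (coordChange x₀ x₁ z) := by
  let flatOrient : M → Orientation ℝ (EuclideanSpace ℝ (Fin m)) (Fin m) := o.orient
  have hflat : ∀ (x : M) (z : EuclideanSpace ℝ (Fin m)), chartSign o.orient x z =
      frameSign (flatOrient ((extChartAt (𝓡 m) x).symm z))
        (fun i => symmDeriv x z (EuclideanSpace.single i (1 : ℝ))) := fun _ _ => rfl
  have hb : ⇑(EuclideanSpace.basisFun (Fin m) ℝ).toBasis =
      fun i => EuclideanSpace.single i (1 : ℝ) := by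
    funext i; simp
  rw [hflat, hflat, symm_coordChange hz, ← symmDeriv_coordChange hz]
  have := alternating_comp_eq_det (EuclideanSpace.basisFun (Fin m) ℝ).toBasis
    ((flatOrient ((extChartAt (𝓡 m) x₀).symm z)).someVector.compLinearMap
      (symmDeriv x₁ (coordChange x₀ x₁ z)).toLinearMap)
    (fderiv ℝ (coordChange x₀ x₁) z).toLinearMap
  rw [hb] at this
  have h2 := congrArg (fun r : ℝ => ((SignType.sign r : SignType) : ℝ)) this
  simp only [sign_mul, SignType.coe_mul] at h2
  exact h2

/-- Two charts give the same integral for an `m`-form which is supported in both of them. -/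
theorem chartIntegral_eq_of_support (o : ManifoldOrientation m M) {σ : Form m M m} {x₀ x₁ : M}
    (h : ∀ x, σ x ≠ 0 → x ∈ (extChartAt (𝓡 m) x₀).source ∧ x ∈ (extChartAt (𝓡 m) x₁).source) :
    chartIntegral o x₀ σ = chartIntegral o x₁ σ := by
  have hrestrict : ∀ (y₀ y₁ : M), (∀ x, σ x ≠ 0 → x ∈ (extChartAt (𝓡 m) y₁).source) →
      chartIntegral o y₀ σ =
        ∫ z in overlap m y₀ y₁, chartSign o.orient y₀ z * topCoeff y₀ σ z := by
    intro y₀ y₁ hy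
    rw [chartIntegral_eq]
    refine setIntegral_eq_of_subset_of_forall_sdiff_eq_zero (isOpen_chart_target y₀).measurableSet
      inter_subset_left fun z hz => ?_
    rw [topCoeff_eq_zero, mul_zero]
    by_contra hne
    exact hz.2 ⟨hz.1, hy _ hne⟩
  rw [hrestrict x₀ x₁ fun x hx => (h x hx).2, hrestrict x₁ x₀ fun x hx => (h x hx).1,
    ← coordChange_image x₀ x₁, integral_image_eq_integral_abs_det_fderiv_smul volume
      (isOpen_overlap x₀ x₁).measurableSet
      (fun z hz => ((contDiffAt_coordChange hz).differentiableAt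
        (by simp)).hasFDerivAt.hasFDerivWithinAt) (coordChange_injOn x₀ x₁)]
  refine setIntegral_congr_fun (isOpen_overlap x₀ x₁).measurableSet fun z hz => ?_
  simp only [smul_eq_mul]
  rw [topCoeff_coordChange σ hz, chartSign_coordChange o hz, ← sign_mul_self]
  ring

variable [T2Space M] [SecondCountableTopology M]

variable (m M) in
theorem tsupport_chartPartition_subset (x₀ : M) :
    tsupport (chartPartition m M x₀) ⊆ (extChartAt (𝓡 m) x₀).source := by
  rw [extChartAt_source]
  exact (exists_chartPartition m M).choose_spec x₀

variable (m) in
/-- Only finitely many functions of the partition of unity meet a compact set. -/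
theorem finite_chartPartition {K : Set M} (hK : IsCompact K) :
    {x₀ : M | ∃ x ∈ K, chartPartition m M x₀ x ≠ 0}.Finite := by
  refine ((chartPartition m M).locallyFinite.finite_nonempty_inter_compact hK).subset ?_
  rintro x₀ ⟨x, hxK, hx⟩
  exact ⟨x, hx, hxK⟩

variable (m) in
theorem sum_chartPartition {K : Set M} (hK : IsCompact K) {x : M} (hx : x ∈ K) :
    ∑ x₀ ∈ (finite_chartPartition m hK).toFinset, chartPartition m M x₀ x = 1 := by
  rw [← (chartPartition m M).sum_eq_one (mem_univ x)]
  symm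
  apply finsum_eq_sum_of_support_subset
  intro x₀ hx₀
  simpa using ⟨x, hx, hx₀⟩

theorem isCompact_tsupport_inter {K : Set M} (hK : IsCompact K) (x₀ : M) :
    IsCompact (tsupport (chartPartition m M x₀) ∩ K) :=
  hK.inter_left (isClosed_tsupport _)

theorem chartPartition_smul_eq_zero {p : ℕ} {σ : Form m M p} {K : Set M} (h0 : ∀ x ∉ K, σ x = 0)
    (x₀ : M) : ∀ x ∉ tsupport (chartPartition m M x₀) ∩ K, chartPartition m M x₀ x • σ x = 0 := by
  intro x hx
  by_cases hxK : x ∈ K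
  · have : x ∉ tsupport (chartPartition m M x₀) := fun h => hx ⟨h, hxK⟩
    rw [image_eq_zero_of_notMem_tsupport this, zero_smul]
  · rw [h0 x hxK, smul_zero]

omit [IsManifold (𝓡 m) ∞ M] [T2Space M] [SecondCountableTopology M] in
theorem chartIntegral_zero_of_forall (o : ManifoldOrientation m M) (x₀ : M) {σ : Form m M m}
    (h : ∀ x, σ x = 0) : chartIntegral o x₀ σ = 0 := by
  rw [chartIntegral_eq]
  simp [topCoeff_eq_zero (h _)]

/-- The finite sum defining the integral may be taken over an index set which depends on the
support only. -/
theorem formIntegral_eq_sum (o : ManifoldOrientation m M) {σ : Form m M m} {K : Set M}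
    (hK : IsCompact K) (h0 : ∀ x ∉ K, σ x = 0) :
    formIntegral o σ = ∑ x₀ ∈ (finite_chartPartition m hK).toFinset,
      chartIntegral o x₀ (fun x => chartPartition m M x₀ x • σ x) := by
  apply finsum_eq_sum_of_support_subset
  intro x₀ hx₀
  simp only [Finite.coe_toFinset, mem_ofPred_eq]
  by_contra! hcon
  apply hx₀
  refine chartIntegral_zero_of_forall o x₀ fun x => ?_
  by_cases hxK : x ∈ K
  · rw [hcon x hxK, zero_smul]
  · rw [h0 x hxK, smul_zero]

theorem continuous_chartPartition (x₀ : M) : Continuous (chartPartition m M x₀) :=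
  (chartPartition m M x₀).contMDiff.continuous

theorem formIntegral_add (o : ManifoldOrientation m M) {σ τ : Form m M m} {K : Set M}
    (hK : IsCompact K) (hσ : IsContinuousTopForm σ) (hτ : IsContinuousTopForm τ)
    (hσ0 : ∀ x ∉ K, σ x = 0) (hτ0 : ∀ x ∉ K, τ x = 0) :
    formIntegral o (σ + τ) = formIntegral o σ + formIntegral o τ := by
  rw [formIntegral_eq_sum o hK hσ0, formIntegral_eq_sum o hK hτ0,
    formIntegral_eq_sum o hK (σ := σ + τ) fun x hx => by
      rw [Pi.add_apply, hσ0 x hx, hτ0 x hx, add_zero], ← Finset.sum_add_distrib]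
  refine Finset.sum_congr rfl fun x₀ _ => ?_
  rw [chartIntegral_eq, chartIntegral_eq, chartIntegral_eq, ← integral_add]
  · congr 1
    funext z
    rw [topCoeff_fun_smul, topCoeff_fun_smul, topCoeff_fun_smul, topCoeff_add, Pi.add_apply]
    ring
  · exact integrableOn_topCoeff o (hσ.smul (continuous_chartPartition x₀))
      (isCompact_tsupport_inter hK x₀)
      (inter_subset_left.trans (tsupport_chartPartition_subset m M x₀))
      (chartPartition_smul_eq_zero hσ0 x₀)
  · exact integrableOn_topCoeff o (hτ.smul (continuous_chartPartition x₀))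
      (isCompact_tsupport_inter hK x₀)
      (inter_subset_left.trans (tsupport_chartPartition_subset m M x₀))
      (chartPartition_smul_eq_zero hτ0 x₀)

/-- The integral of an `m`-form which is supported in a chart is computed in this chart. -/
theorem formIntegral_eq_chartIntegral (o : ManifoldOrientation m M) {σ : Form m M m} {K : Set M}
    (hK : IsCompact K) {x₁ : M} (hKs : K ⊆ (extChartAt (𝓡 m) x₁).source)
    (hσ : IsContinuousTopForm σ) (h0 : ∀ x ∉ K, σ x = 0) :
    formIntegral o σ = chartIntegral o x₁ σ := by
  rw [formIntegral_eq_sum o hK h0]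
  have h1 : ∀ x₀, chartIntegral o x₀ (fun x => chartPartition m M x₀ x • σ x) =
      chartIntegral o x₁ (fun x => chartPartition m M x₀ x • σ x) := by
    intro x₀
    refine chartIntegral_eq_of_support o fun x hx => ?_
    have hmem : x ∈ tsupport (chartPartition m M x₀) ∩ K := by
      by_contra hcon
      exact hx (chartPartition_smul_eq_zero h0 x₀ x hcon)
    exact ⟨tsupport_chartPartition_subset m M x₀ hmem.1, hKs hmem.2⟩
  simp only [h1, chartIntegral_eq]
  rw [← integral_finsetSum]
  · refine setIntegral_congr_fun (isOpen_chart_target x₁).measurableSet fun z hz => ?_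
    simp only [topCoeff_fun_smul]
    rw [← Finset.mul_sum, ← Finset.sum_mul]
    by_cases hzK : (extChartAt (𝓡 m) x₁).symm z ∈ K
    · rw [sum_chartPartition m hK hzK, one_mul]
    · rw [topCoeff_eq_zero (h0 _ hzK), mul_zero]
  · intro x₀ _
    refine integrableOn_topCoeff o (hσ.smul (continuous_chartPartition x₀)) hK hKs fun x hx => ?_
    rw [h0 x hx, smul_zero]

end Integration

/-! ### The formal adjoint of the exterior derivative -/

section Adjoint

variable {m : ℕ} {M : Type*} [TopologicalSpace M] [ChartedSpace (EuclideanSpace ℝ (Fin m)) M]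

theorem IsSmoothForm.add {p : ℕ} {u v : Form m M p} (hu : IsSmoothForm u) (hv : IsSmoothForm v) :
    IsSmoothForm (u + v) := fun x₀ => (hu x₀).add (hv x₀)

theorem IsSmoothForm.const_smul {p : ℕ} (c : ℝ) {u : Form m M p} (hu : IsSmoothForm u) :
    IsSmoothForm (c • u) := fun x₀ => (hu x₀).const_smul c

theorem isSmoothForm_zero {p : ℕ} : IsSmoothForm (0 : Form m M p) := fun x₀ => by
  rw [inChart_zero]
  exact contDiffOn_const

theorem IsSmoothForm.sum {p : ℕ} {ι : Type*} (s : Finset ι) {u : ι → Form m M p}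
    (hu : ∀ i, IsSmoothForm (u i)) : IsSmoothForm (∑ i ∈ s, u i) := by
  classical
  induction s using Finset.induction_on with
  | empty => simpa using isSmoothForm_zero
  | insert i s hi ih => rw [Finset.sum_insert hi]; exact (hu i).add ih

theorem extDer_eq_zero_of_notMem {p : ℕ} {u : Form m M p} {K : Set M} (hK : IsClosed K)
    (h0 : ∀ x ∉ K, u x = 0) {x : M} (hx : x ∉ K) : extDer u x = 0 := by
  change flatForm (extDer u) x = 0
  have : inChart x u =ᶠ[𝓝 (extChartAt (𝓡 m) x x)] fun _ => 0 := by
    have hc : ContinuousAt (extChartAt (𝓡 m) x).symm (extChartAt (𝓡 m) x x) :=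
      continuousAt_extChartAt_symm x
    have hmem : Kᶜ ∈ 𝓝 ((extChartAt (𝓡 m) x).symm (extChartAt (𝓡 m) x x)) := by
      rw [extChartAt_to_inv]
      exact hK.isOpen_compl.mem_nhds hx
    filter_upwards [hc hmem] with z hz using inChart_eq_zero (h0 _ hz)
  rw [flatForm_extDer, this.extDeriv_eq, extDeriv, fderiv_const_apply,
    ← ContinuousAlternatingMap.alternatizeUncurryFinCLM_apply, map_zero]
  rfl

variable [RiemannianBundle (fun x : M => TangentSpace (𝓡 m) x)]

theorem starForm_add (o : ManifoldOrientation m M) {p q : ℕ} (h : p + q = m) (u v : Form m M p) :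
    starForm o h (u + v) = starForm o h u + starForm o h v :=
  funext fun _ => hodgeStar_add _ _ _ _

theorem starForm_smul (o : ManifoldOrientation m M) {p q : ℕ} (h : p + q = m) (c : ℝ)
    (u : Form m M p) : starForm o h (c • u) = c • starForm o h u :=
  funext fun _ => hodgeStar_smul _ _ _ _

/-- The `m`-form `⟨u, v⟩ dV`. -/
def innerForm (o : ManifoldOrientation m M) {p : ℕ} (u v : Form m M p) : Form m M m :=
  fun x => formInner (u x) (v x) • volForm (o.orient x)

theorem formInner_add_left {V : Type*} [NormedAddCommGroup V] [InnerProductSpace ℝ V]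
    [FiniteDimensional ℝ V] {p : ℕ} (a b c : V [⋀^Fin p]→L[ℝ] ℝ) :
    formInner (a + b) c = formInner a c + formInner b c := by
  simp [formInner, add_mul, Finset.sum_add_distrib]

theorem formInner_zero_left {V : Type*} [NormedAddCommGroup V] [InnerProductSpace ℝ V]
    [FiniteDimensional ℝ V] {p : ℕ} (c : V [⋀^Fin p]→L[ℝ] ℝ) : formInner 0 c = 0 := by
  simp [formInner]

theorem formInner_zero_right {V : Type*} [NormedAddCommGroup V] [InnerProductSpace ℝ V]
    [FiniteDimensional ℝ V] {p : ℕ} (c : V [⋀^Fin p]→L[ℝ] ℝ) : formInner c 0 = 0 := by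
  simp [formInner]

theorem innerForm_add_left (o : ManifoldOrientation m M) {p : ℕ} (u₁ u₂ v : Form m M p) :
    innerForm o (u₁ + u₂) v = innerForm o u₁ v + innerForm o u₂ v := by
  funext x
  change formInner (u₁ x + u₂ x) (v x) • volForm (o.orient x) = _
  rw [formInner_add_left, add_smul]
  rfl

theorem innerForm_eq_zero_left (o : ManifoldOrientation m M) {p : ℕ} {u v : Form m M p} {x : M}
    (h : u x = 0) : innerForm o u v x = 0 := by
  rw [innerForm, h, formInner_zero_left, zero_smul]

/-- In a chart, the coefficient of `⟨u, v⟩ dV = u ∧ ⋆v` is the exterior product of the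
expressions of `u` and `⋆v`, in which the metric no longer appears. -/
theorem topCoeff_innerForm (o : ManifoldOrientation m M) {p q : ℕ} (h : p + q = m)
    (u v : Form m M p) (x₀ : M) (z : EuclideanSpace ℝ (Fin m)) :
    topCoeff x₀ (innerForm o u v) z = wedgePairing _ h (fun i => EuclideanSpace.single i (1 : ℝ))
      (inChart x₀ u z) (inChart x₀ (starForm o h v) z) := by
  set y := (extChartAt (𝓡 m) x₀).symm z with hy
  rw [wedgePairing_apply]
  have h1 := congrArg (fun f => f (coordFrame x₀ z)) (wedge_hodgeStar (o.orient y) h (u y) (v y))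
  let L : EuclideanSpace ℝ (Fin m) →L[ℝ] TangentSpace (𝓡 m) y := symmDeriv x₀ z
  have h2 := wedge_compContinuousLinearMap h L (u y) (hodgeStar (o.orient y) h (v y))
    (fun i => EuclideanSpace.single i (1 : ℝ))
  exact (h2.trans h1).symm

variable [IsManifold (𝓡 m) ∞ M]
variable [IsContMDiffRiemannianBundle (𝓡 m) ∞ (EuclideanSpace ℝ (Fin m))
      (fun x : M => TangentSpace (𝓡 m) x)]

theorem IsSmoothForm.isContinuousTopForm_innerForm (o : ManifoldOrientation m M) {p q : ℕ}
    (h : p + q = m) {u v : Form m M p} (hu : IsSmoothForm u) (hv : IsSmoothForm v) :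
    IsContinuousTopForm (innerForm o u v) := by
  intro x₀
  simp only [funext fun z => topCoeff_innerForm o h u v x₀ z]
  exact ((wedgePairing _ h _).continuous.comp_continuousOn (hu x₀).continuousOn).clm_apply
    (hv.starForm o h x₀).continuousOn

theorem coDer_smooth (o : ManifoldOrientation m M) (k : ℕ) {v : Form m M (k + 1)}
    (hv : IsSmoothForm v) : IsSmoothForm (coDer o k v) := by
  unfold coDer
  split_ifs with h
  · exact ((hv.starForm o _).extDer.starForm o _).const_smul _
  · exact isSmoothForm_zero

omit [RiemannianBundle (fun x : M => TangentSpace (𝓡 m) x)]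
  [IsContMDiffRiemannianBundle (𝓡 m) ∞ (EuclideanSpace ℝ (Fin m))
    (fun x : M => TangentSpace (𝓡 m) x)] in
theorem isLinearOnSmoothForms_extDer (k : ℕ) :
    IsLinearOnSmoothForms (extDer : Form m M k → Form m M (k + 1)) where
  smooth _ hu := hu.extDer
  add _ _ hu hv := extDer_add hu hv
  smul c u _ := extDer_smul c u

theorem isLinearOnSmoothForms_coDer (o : ManifoldOrientation m M) (k : ℕ) :
    IsLinearOnSmoothForms (coDer o k) where
  smooth _ hv := coDer_smooth o k hv
  add u v hu hv := by
    unfold coDer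
    split_ifs with h
    · rw [starForm_add, extDer_add (hu.starForm o _) (hv.starForm o _), starForm_add, smul_add]
    · rw [add_zero]
  smul c u hu := by
    unfold coDer
    split_ifs with h
    · rw [starForm_smul, extDer_smul, starForm_smul, smul_comm]
    · rw [smul_zero]

/-- `⋆ d^⋆ v = (-1)^{k + 1} d ⋆ v` on `(k + 1)`-forms. -/
theorem starForm_coDer (o : ManifoldOrientation m M) {k q : ℕ} (h₁ : k + 1 + q = m)
    (h₂ : k + (q + 1) = m) (v : Form m M (k + 1)) :
    starForm o h₂ (coDer o k v) = (-1 : ℝ) ^ (k + 1) • extDer (starForm o h₁ v) := by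
  obtain rfl : q = m - (k + 1) := by omega
  rw [coDer, dif_pos (by omega), starForm_smul]
  funext x
  have hpow : (-1 : ℝ) ^ (m * (k + 1 + 1) + 1) * (-1) ^ ((m - (k + 1) + 1) * k) =
      (-1) ^ (k + 1) := by
    generalize m - (k + 1) = q at h₁
    subst h₁
    rw [← pow_add]
    have : (k + 1 + q) * (k + 1 + 1) + 1 + (q + 1) * k =
        (k + 1) + 2 * ((q + 1) * k + (q + 1)) + k * (k + 1) := by ring
    rw [this, pow_add, pow_add, Even.neg_one_pow (Nat.even_mul_succ_self k), pow_mul]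
    simp
  have hstar := hodgeStar_hodgeStar (o.orient x) (show m - (k + 1) + 1 + k = m by omega) h₂
    (extDer (starForm o h₁ v) x)
  refine (congrArg (fun a => (-1 : ℝ) ^ (m * (k + 1 + 1) + 1) • a) hstar).trans ?_
  rw [smul_smul, hpow]
  rfl

variable [T2Space M] [SecondCountableTopology M]

omit [IsContMDiffRiemannianBundle (𝓡 m) ∞ (EuclideanSpace ℝ (Fin m))
    (fun x : M => TangentSpace (𝓡 m) x)] in
theorem l2Inner_eq (o : ManifoldOrientation m M) {p : ℕ} (u v : Form m M p) :
    l2Inner o u v = formIntegral o (innerForm o u v) := rfl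

/-- The adjointness relation for forms `u` which are supported in a chart: by Stokes' theorem in
coordinates, applied to `u ∧ ⋆v`. -/
theorem l2Inner_extDer_eq_of_chart (o : ManifoldOrientation m M) {k : ℕ} (hk : k + 1 ≤ m)
    {u : Form m M k} {v : Form m M (k + 1)} (hu : IsSmoothForm u) (hv : IsSmoothForm v)
    {K : Set M} (hK : IsCompact K) {x₀ : M} (hKs : K ⊆ (extChartAt (𝓡 m) x₀).source)
    (h0 : ∀ x ∉ K, u x = 0) :
    l2Inner o (extDer u) v = l2Inner o u (coDer o k v) := by
  obtain ⟨q, h₁⟩ := Nat.exists_eq_add_of_le hk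
  replace h₁ : k + 1 + q = m := h₁.symm
  have h₂ : k + (q + 1) = m := by omega
  have hdu : ∀ x ∉ K, extDer u x = 0 := fun x hx => extDer_eq_zero_of_notMem hK.isClosed h0 hx
  have hc₁ := hu.extDer.isContinuousTopForm_innerForm o h₁ hv
  have hc₂ := hu.isContinuousTopForm_innerForm o h₂ (coDer_smooth o k hv)
  have hz₁ : ∀ x ∉ K, innerForm o (extDer u) v x = 0 := fun x hx =>
    innerForm_eq_zero_left o (hdu x hx)
  have hz₂ : ∀ x ∉ K, innerForm o u (coDer o k v) x = 0 := fun x hx =>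
    innerForm_eq_zero_left o (h0 x hx)
  rw [l2Inner_eq, l2Inner_eq, formIntegral_eq_chartIntegral o hK hKs hc₁ hz₁,
    formIntegral_eq_chartIntegral o hK hKs hc₂ hz₂, ← sub_eq_zero, chartIntegral_eq,
    chartIntegral_eq, ← integral_sub (integrableOn_topCoeff o hc₁ hK hKs hz₁)
      (integrableOn_topCoeff o hc₂ hK hKs hz₂)]
  obtain ⟨hK₁, hK₂, hK₃⟩ := isCompact_image_chart hK hKs
  rw [← setIntegral_stokes h₁ h₂ (fun i => EuclideanSpace.single i (1 : ℝ))
    (isOpen_chart_target x₀) hK₁ hK₂ (fun z hz => chartSign_eventuallyEq o hz) (hu x₀)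
    (hv.starForm o h₁ x₀) fun z hz => inChart_eq_zero (h0 _ (hK₃ z hz))]
  refine setIntegral_congr_fun (isOpen_chart_target x₀).measurableSet fun z hz => ?_
  rw [topCoeff_innerForm o h₁, topCoeff_innerForm o h₂, starForm_coDer o h₁ h₂, inChart_smul,
    Pi.smul_apply, map_smul, smul_eq_mul, inChart_extDer hu hz,
    inChart_extDer (hv.starForm o h₁) hz]
  ring

omit [RiemannianBundle (fun x : M => TangentSpace (𝓡 m) x)]
  [IsContMDiffRiemannianBundle (𝓡 m) ∞ (EuclideanSpace ℝ (Fin m))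
    (fun x : M => TangentSpace (𝓡 m) x)] in
theorem IsSmoothForm.chartPartition_smul {p : ℕ} {u : Form m M p} (hu : IsSmoothForm u) (x₁ : M) :
    IsSmoothForm (fun x => chartPartition m M x₁ x • u x) := by
  intro x₀
  have h : ContDiffOn ℝ ∞ (fun z => chartPartition m M x₁ ((extChartAt (𝓡 m) x₀).symm z))
      (extChartAt (𝓡 m) x₀).target := by
    rw [← contMDiffOn_iff_contDiffOn]
    exact (chartPartition m M x₁).contMDiff.comp_contMDiffOn (contMDiffOn_extChartAt_symm x₀)
  exact h.fun_smul (hu x₀)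

omit [IsContMDiffRiemannianBundle (𝓡 m) ∞ (EuclideanSpace ℝ (Fin m))
    (fun x : M => TangentSpace (𝓡 m) x)] in
theorem l2Inner_zero_left (o : ManifoldOrientation m M) {p : ℕ} (v : Form m M p) :
    l2Inner o 0 v = 0 := by
  rw [l2Inner_eq, formIntegral_eq_sum o isCompact_empty fun x _ => innerForm_eq_zero_left o rfl]
  exact Finset.sum_eq_zero fun x₀ _ => chartIntegral_zero_of_forall o x₀ fun x => by
    rw [innerForm_eq_zero_left o rfl, smul_zero]

omit [IsContMDiffRiemannianBundle (𝓡 m) ∞ (EuclideanSpace ℝ (Fin m))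
    (fun x : M => TangentSpace (𝓡 m) x)] in
theorem l2Inner_zero_right (o : ManifoldOrientation m M) {p : ℕ} (u : Form m M p) :
    l2Inner o u 0 = 0 := by
  rw [← l2Inner_zero_left o (0 : Form m M p), l2Inner_eq, l2Inner_eq]
  congr 1
  funext x
  change formInner _ 0 • _ = formInner 0 _ • _
  rw [formInner_zero_left, formInner_zero_right]

theorem l2Inner_add_left (o : ManifoldOrientation m M) {p q : ℕ} (h : p + q = m)
    {u₁ u₂ v : Form m M p} (h₁ : IsSmoothForm u₁) (h₂ : IsSmoothForm u₂) (hv : IsSmoothForm v)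
    {K : Set M} (hK : IsCompact K) (h0₁ : ∀ x ∉ K, u₁ x = 0) (h0₂ : ∀ x ∉ K, u₂ x = 0) :
    l2Inner o (u₁ + u₂) v = l2Inner o u₁ v + l2Inner o u₂ v := by
  rw [l2Inner_eq, innerForm_add_left, formIntegral_add o hK
    (h₁.isContinuousTopForm_innerForm o h hv) (h₂.isContinuousTopForm_innerForm o h hv)
    (fun x hx => innerForm_eq_zero_left o (h0₁ x hx))
    (fun x hx => innerForm_eq_zero_left o (h0₂ x hx))]
  rfl

/-- The adjointness relation for compactly supported `u`, by decomposing `u` with the partition of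
unity. -/
theorem l2Inner_extDer_eq (o : ManifoldOrientation m M) {k : ℕ} (hk : k + 1 ≤ m)
    {u : Form m M k} {v : Form m M (k + 1)} (hu : IsSmoothForm u) (hv : IsSmoothForm v)
    (huc : IsCompactlySupported u) :
    l2Inner o (extDer u) v = l2Inner o u (coDer o k v) := by
  classical
  obtain ⟨q, h₁⟩ := Nat.exists_eq_add_of_le hk
  replace h₁ : k + 1 + q = m := h₁.symm
  have h₂ : k + (q + 1) = m := by omega
  set K := closure {x : M | u x ≠ 0} with hKdef
  have hK : IsCompact K := huc
  have h0 : ∀ x ∉ K, u x = 0 := fun x hx => by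
    by_contra hne
    exact hx (subset_closure hne)
  let w : M → Form m M k := fun x₁ x => chartPartition m M x₁ x • u x
  have hw : ∀ x₁, IsSmoothForm (w x₁) := fun x₁ => hu.chartPartition_smul x₁
  have hw0 : ∀ x₁, ∀ x ∉ K, w x₁ x = 0 := fun x₁ x hx => by
    simp only [w, h0 x hx, smul_zero]
  have hsum : u = ∑ x₁ ∈ (finite_chartPartition m hK).toFinset, w x₁ := by
    funext x
    simp only [Finset.sum_apply, w]
    rw [← Finset.sum_smul]
    by_cases hx : x ∈ K
    · rw [sum_chartPartition m hK hx, one_smul]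
    · rw [h0 x hx, smul_zero]
  have key : ∀ s : Finset M, l2Inner o (extDer (∑ x₁ ∈ s, w x₁)) v =
      l2Inner o (∑ x₁ ∈ s, w x₁) (coDer o k v) := by
    intro s
    induction s using Finset.induction_on with
    | empty =>
      have : extDer (0 : Form m M k) = 0 := by
        have := extDer_smul (0 : ℝ) (0 : Form m M k)
        rwa [zero_smul, zero_smul] at this
      rw [Finset.sum_empty, this, l2Inner_zero_left, l2Inner_zero_left]
    | insert x₁ s hx₁ ih =>
      have hs0 : ∀ x ∉ K, (∑ x₁ ∈ s, w x₁) x = 0 := fun x hx => by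
        rw [Finset.sum_apply]
        exact Finset.sum_eq_zero fun x₁ _ => hw0 x₁ x hx
      have hss := IsSmoothForm.sum s hw
      rw [Finset.sum_insert hx₁, extDer_add (hw x₁) hss,
        l2Inner_add_left o h₁ (hw x₁).extDer hss.extDer hv hK
          (fun x hx => extDer_eq_zero_of_notMem hK.isClosed (hw0 x₁) hx)
          (fun x hx => extDer_eq_zero_of_notMem hK.isClosed hs0 hx),
        l2Inner_add_left o h₂ (hw x₁) hss (coDer_smooth o k hv) hK (hw0 x₁) hs0, ih,
        l2Inner_extDer_eq_of_chart o hk (hw x₁) hv (isCompact_tsupport_inter hK x₁)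
          (inter_subset_left.trans (tsupport_chartPartition_subset m M x₁))
          (chartPartition_smul_eq_zero h0 x₁)]
  have := key (finite_chartPartition m hK).toFinset
  rwa [← hsum] at this

theorem formInner_eq_zero_of_finrank_lt {V : Type*} [NormedAddCommGroup V] [InnerProductSpace ℝ V]
    [FiniteDimensional ℝ V] {p : ℕ} (h : Module.finrank ℝ V < p) (a b : V [⋀^Fin p]→L[ℝ] ℝ) :
    formInner a b = 0 := by
  have : IsEmpty (Fin p ↪o Fin (Module.finrank ℝ V)) := ⟨fun I => by
    have := Fintype.card_le_of_injective I I.injective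
    simp only [Fintype.card_fin] at this
    omega⟩
  simp [formInner]

theorem isFormalAdjoint_extDer_coDer (o : ManifoldOrientation m M) (k : ℕ) :
    IsFormalAdjoint o (extDer : Form m M k → Form m M (k + 1)) (coDer o k) where
  linear := isLinearOnSmoothForms_extDer k
  linear_adjoint := isLinearOnSmoothForms_coDer o k
  l2Inner_eq u v hu huc hv _ := by
    by_cases hk : k + 1 ≤ m
    · exact l2Inner_extDer_eq o hk hu hv huc
    · -- there are no nonzero `(k + 1)`-forms, so both integrands vanish
      have h1 : coDer o k v = 0 := by rw [coDer, dif_neg hk]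
      rw [h1, l2Inner_zero_right, ← l2Inner_zero_left o v, l2Inner_eq, l2Inner_eq]
      congr 1
      funext x
      have hlt : Module.finrank ℝ (TangentSpace (𝓡 m) x) < k + 1 := by
        have : Module.finrank ℝ (TangentSpace (𝓡 m) x) = m := Fact.out
        omega
      rw [innerForm, innerForm, formInner_eq_zero_of_finrank_lt hlt,
        formInner_eq_zero_of_finrank_lt hlt]

end Adjoint

end RiemannianForms

end

theorem mainTheorem12 {m : ℕ} {M : Type*} [TopologicalSpace M]
    [ChartedSpace (EuclideanSpace ℝ (Fin m)) M] [IsManifold (𝓡 m) ∞ M]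
    [T2Space M] [SecondCountableTopology M]
    [RiemannianBundle (fun x : M => TangentSpace (𝓡 m) x)]
    [IsContMDiffRiemannianBundle (𝓡 m) ∞ (EuclideanSpace ℝ (Fin m))
      (fun x : M => TangentSpace (𝓡 m) x)]
    (o : RiemannianForms.ManifoldOrientation m M) (k : ℕ) :
    RiemannianForms.IsFormalAdjoint o
      (RiemannianForms.extDer : RiemannianForms.Form m M k → RiemannianForms.Form m M (k + 1))
      (RiemannianForms.coDer o k) :=
  RiemannianForms.isFormalAdjoint_extDer_coDer o k
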